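/- Let $G$ be a finite abelian group (written additively) of order $n$. A sequence over $G$ is a finite unordered sequence of elements of $G$ with repetition allowed; write $|S|$ for the length of a sequence $S$ and $\mathrm{supp}(S)$ for the set of distinct terms of $S$. For $k\ge 1$ let $\Sigma_k(S)\subseteq G$ be the set of all sums of the subsequences of $S$ of length $k$, and let $\Sigma(S)=\bigcup_{k=1}^{|S|}\Sigma_k(S)$. Let $\mathsf D(G)$ be the Davenport constant of $G$, that is, the smallest $\ell$ such that $0\in\Sigma(T)$ for every sequence $T$ over $G$ of length $\ell$. Let $S$ be a sequence over $G$ with $|S|=n+r$, where $r$ is an integer with $1\le r\le \mathsf D(G)-2$. If $0\notin\Sigma_n(S)$, then $$|\Sigma_n(S)|\ \ge\ r+|\mathrm{supp}(S)|-1.$$ -/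

import Mathlib

/-! A (finite, unordered) sequence over an abelian group `G` is a `Multiset G`, that is, an element
of the free abelian monoid with basis `G`; its length is `Multiset.card`, its sum is
`Multiset.sum`, and `T` is a subsequence of `S` if and only if `T ≤ S`. -/

namespace SeqOver

variable {G : Type*} [AddCommGroup G]

/-- The support of a sequence: the set of its distinct terms. -/
def supp (S : Multiset G) : Set G := {g | g ∈ S}

/-- `Σ_k(S)`: the set of sums of the subsequences of `S` of length `k`. -/
def sumsOfLength (k : ℕ) (S : Multiset G) : Set G :=
  {g | ∃ T : Multiset G, T ≤ S ∧ Multiset.card T = k ∧ T.sum = g}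

/-- `Σ(S)`: the union of the sets `Σ_k(S)` for `1 ≤ k ≤ |S|`. -/
def subsums (S : Multiset G) : Set G :=
  ⋃ k ∈ Set.Icc 1 (Multiset.card S), sumsOfLength k S

/-- The Davenport constant `D(G)`: the smallest `ℓ` such that `0 ∈ Σ(S)` for every sequence `S`
over `G` of length `ℓ`. (Such an `ℓ` exists when `G` is finite, see `exists_davenport`.) -/
noncomputable def davenport (G : Type*) [AddCommGroup G] : ℕ :=
  sInf {ℓ : ℕ | ∀ S : Multiset G, Multiset.card S = ℓ → (0 : G) ∈ subsums S}

/-- The set whose infimum defines the Davenport constant is nonempty for finite `G`. -/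
theorem exists_davenport (G : Type*) [AddCommGroup G] [Finite G] :
    {ℓ : ℕ | ∀ S : Multiset G, Multiset.card S = ℓ → (0 : G) ∈ subsums S}.Nonempty := by
  classical
  have : Fintype G := Fintype.ofFinite G
  refine ⟨Fintype.card G, fun S hS => ?_⟩
  obtain ⟨l, rfl⟩ := Quot.exists_rep S
  have hl : l.length = Fintype.card G := hS
  -- two of the partial sums coincide
  obtain ⟨i, j, hij, h⟩ := Fintype.exists_ne_map_eq_of_card_lt
    (fun i : Fin (l.length + 1) => (l.take i).sum) (by simp [hl])
  wlog hlt : i < j generalizing i j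
  · exact this j i hij.symm h.symm (lt_of_le_of_ne (not_lt.mp hlt) hij.symm)
  have hlt' : (i : ℕ) < j := hlt
  have hj : (j : ℕ) ≤ l.length := Nat.lt_succ_iff.mp j.2
  have hlen : ((l.take j).drop i).length = j - i := by simp [hj]
  have hsum : ((l.take j).drop i).sum = 0 := by
    have h1 := List.sum_take_add_sum_drop (l.take j) i
    rw [List.take_take, min_eq_left hlt'.le] at h1
    have h' : (l.take i).sum = (l.take j).sum := h
    rw [h'] at h1
    simpa using h1
  simp only [subsums, Set.mem_iUnion]
  refine ⟨j - i, ⟨by omega, ?_⟩, (((l.take j).drop i : List G) : Multiset G), ?_, ?_, ?_⟩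
  · change (j : ℕ) - i ≤ l.length
    omega
  · exact Multiset.coe_le.mpr
      (((List.drop_sublist _ _).trans (List.take_sublist _ _)).subperm)
  · simpa using hlen
  · simpa using hsum

end SeqOver

open Finset
open scoped Pointwise

namespace SeqOver

universe u

set_option linter.unusedSectionVars false

/-! ### Periods and stabilizers of finite sets -/

section Basics

variable {G : Type u} [AddCommGroup G]

/-! Complementation gives Σ_n(S) = σ(S) − Σ_r(S), so the hypothesis reads σ(S) ∉ Σ_r(S) and |Σ_r(S)|
is to be bounded below. Modulo the stabilizer of Σ_r(S) this set becomes aperiodic, and the order of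
the quotient group still divides n.

In the aperiodic case the DeVos–Goddyn–Mohar inequality `Aper.sum_min_count_le` forces some q to
occur more than r times: otherwise it gives |Σ_r(S)| ≥ n + 1. Translating q to 0 turns Σ_r(S) into
the set of sums of at most r nonzero terms, since zeros serve as padding.

It remains to prove `supportBound`, by induction on r with deletion of one term. A repeated term is
deleted without loss of support, and aperiodicity makes the set of sums grow strictly. If the terms
form a set A and the bound fails, translation by each g ∈ A moves exactly one point out of the set Y
of sums. By an exchange argument these translations all leave from one point or all land on one
point. In the former case Y minus that point is closed under adding A and contains σ(A), a
contradiction; in the latter Y ∪ {σ(A)} is a group, too small to avoid representing σ(A) by few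
terms (`false_of_card_le`).

Both Kneser's theorem and the DeVos–Goddyn–Mohar inequality come from one kind of descent: a
periodic subset of the sumset satisfying a size inequality is enlarged inside a coset where the
sumset has a hole, while its period shrinks, until the period is trivial. -/

/-- The sums of the subsequences of length `r`, as a finite set. -/
def sums [DecidableEq G] (r : ℕ) (S : Multiset G) : Finset G :=
  ((S.powersetCard r).map Multiset.sum).toFinset

theorem mem_sums [DecidableEq G] {r : ℕ} {S : Multiset G} {y : G} :
    y ∈ sums r S ↔ ∃ U ≤ S, Multiset.card U = r ∧ U.sum = y := by
  simp only [sums, Multiset.mem_toFinset, Multiset.mem_map, Multiset.mem_powersetCard, and_assoc]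

theorem image_sums {G' : Type*} [AddCommGroup G'] [DecidableEq G] [DecidableEq G'] (f : G →+ G')
    (r : ℕ) (S : Multiset G) : (sums r S).image f = sums r (S.map f) := by
  ext y
  simp only [sums, Multiset.powersetCard_map, Finset.mem_image, Multiset.mem_toFinset,
    Multiset.mem_map, Multiset.map_map, Function.comp]
  constructor
  · rintro ⟨_, ⟨U, hU, rfl⟩, rfl⟩
    exact ⟨U, hU, by simp [map_multiset_sum]⟩
  · rintro ⟨U, hU, rfl⟩
    exact ⟨_, ⟨U, hU, rfl⟩, by simp [map_multiset_sum]⟩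

theorem sums_nonempty [DecidableEq G] {r : ℕ} {S : Multiset G} (h : r ≤ Multiset.card S) :
    (sums r S).Nonempty := by
  have h1 : 0 < Multiset.card (S.powersetCard r) := by
    rw [Multiset.card_powersetCard]
    exact Nat.choose_pos h
  obtain ⟨U, hU⟩ := Multiset.card_pos_iff_exists_mem.1 h1
  exact ⟨U.sum, mem_sums.2 ⟨U, (Multiset.mem_powersetCard.1 hU).1,
    (Multiset.mem_powersetCard.1 hU).2, rfl⟩⟩

/-- A finite set without nonzero periods. -/
def Aper (Y : Finset G) : Prop := ∀ x, (∀ y ∈ Y, x + y ∈ Y) → x = 0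

/-- A finite set that is a union of cosets of `H`. -/
def IsPer (H : AddSubgroup G) (Y : Finset G) : Prop := ∀ h ∈ H, ∀ y ∈ Y, h + y ∈ Y

/-- The stabilizer of a finite set under translation. -/
def stab (Y : Finset G) : AddSubgroup G where
  carrier := {x | ∀ y ∈ Y, x + y ∈ Y}
  zero_mem' := by simp
  add_mem' := by
    intro a b ha hb y hy
    rw [add_assoc]
    exact ha _ (hb _ hy)
  neg_mem' := by
    classical
    intro a ha y hy
    have h1 : Y.image (a + ·) = Y :=
      Finset.eq_of_subset_of_card_le (Finset.image_subset_iff.2 ha)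
        (by rw [Finset.card_image_of_injective _ (add_right_injective a)])
    rw [← h1, Finset.mem_image] at hy
    obtain ⟨z, hz, rfl⟩ := hy
    simpa using hz

theorem isPer_stab (Y : Finset G) : IsPer (stab Y) Y := fun _ h => h

theorem IsPer.mono {H K : AddSubgroup G} {Y : Finset G} (h : IsPer H Y) (hK : K ≤ H) :
    IsPer K Y := fun k hk => h k (hK hk)

theorem IsPer.union [DecidableEq G] {H : AddSubgroup G} {Y Z : Finset G} (h : IsPer H Y)
    (h' : IsPer H Z) : IsPer H (Y ∪ Z) := by
  intro k hk y hy
  rcases Finset.mem_union.1 hy with hy | hy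
  · exact Finset.mem_union_left _ (h k hk y hy)
  · exact Finset.mem_union_right _ (h' k hk y hy)

theorem IsPer.of_sub_mem {H : AddSubgroup G} {Y : Finset G} (h : IsPer H Y) {x y : G}
    (hy : y ∈ Y) (hxy : x - y ∈ H) : x ∈ Y := by
  simpa using h _ hxy y hy

theorem Aper.of_add_left [DecidableEq G] {A B : Finset G} (h : Aper (A + B)) : Aper A := by
  intro x hx
  apply h
  intro y hy
  obtain ⟨a, ha, b, hb, rfl⟩ := Finset.mem_add.1 hy
  rw [← add_assoc]
  exact Finset.add_mem_add (hx a ha) hb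

theorem Aper.of_add_right [DecidableEq G] {A B : Finset G} (h : Aper (A + B)) : Aper B := by
  rw [add_comm] at h
  exact h.of_add_left

/-- A period of the image lifts to a period of `Y`, because `Y` is a union of cosets of its
stabilizer. All reductions to the aperiodic case rest on this. -/
theorem aper_image_stab (Y : Finset G) [DecidableEq (G ⧸ stab Y)] :
    Aper (Y.image (QuotientAddGroup.mk' (stab Y))) := by
  intro q hq
  obtain ⟨x, rfl⟩ := QuotientAddGroup.mk'_surjective _ q
  have : x ∈ stab Y := by
    intro y hy
    have h1 := hq _ (Finset.mem_image_of_mem _ hy)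
    rw [← map_add, Finset.mem_image] at h1
    obtain ⟨z, hz, hzx⟩ := h1
    refine (isPer_stab Y).of_sub_mem hz ?_
    simpa [neg_add_eq_sub] using QuotientAddGroup.eq.1 hzx
  simpa using this

end Basics

/-! ### Coset closures and multiplicities modulo a subgroup -/

section Finite

variable {G : Type u} [AddCommGroup G] [Fintype G] [DecidableEq G]

open Classical in
/-- The union of the cosets of `H` that meet `E`. -/
noncomputable def cl (H : AddSubgroup G) (E : Finset G) : Finset G :=
  univ.filter fun x => ∃ e ∈ E, x - e ∈ H

theorem mem_cl {H : AddSubgroup G} {E : Finset G} {x : G} : x ∈ cl H E ↔ ∃ e ∈ E, x - e ∈ H := by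
  simp [cl]

theorem subset_cl (H : AddSubgroup G) (E : Finset G) : E ⊆ cl H E :=
  fun x hx => mem_cl.2 ⟨x, hx, by simp⟩

theorem IsPer.cl_eq {H : AddSubgroup G} {E : Finset G} (h : IsPer H E) : cl H E = E := by
  refine Finset.Subset.antisymm (fun x hx => ?_) (subset_cl H E)
  obtain ⟨e, he, hxe⟩ := mem_cl.1 hx
  exact h.of_sub_mem he hxe

theorem cl_mono_left {H K : AddSubgroup G} (h : K ≤ H) (E : Finset G) : cl K E ⊆ cl H E := by
  intro x hx
  obtain ⟨e, he, hxe⟩ := mem_cl.1 hx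
  exact mem_cl.2 ⟨e, he, h hxe⟩

theorem cl_union (H : AddSubgroup G) (E F : Finset G) : cl H (E ∪ F) = cl H E ∪ cl H F := by
  ext x
  simp only [mem_cl, Finset.mem_union, or_and_right, exists_or]

theorem cl_empty (H : AddSubgroup G) : cl H (∅ : Finset G) = ∅ := by
  ext x
  simp [mem_cl]

theorem cl_bot (E : Finset G) : cl ⊥ E = E := by
  ext x
  simp [mem_cl, sub_eq_zero]

theorem card_fiber_mk (H : AddSubgroup G) [DecidableEq (G ⧸ H)] (q : G ⧸ H) :
    (univ.filter fun x : G => QuotientAddGroup.mk' H x = q).card = Nat.card H := by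
  classical
  obtain ⟨a, rfl⟩ := QuotientAddGroup.mk'_surjective _ q
  rw [Nat.card_eq_fintype_card, ← Finset.card_univ]
  symm
  refine Finset.card_bij (fun h _ => a + (h : G)) ?_ ?_ ?_
  · intro h _
    rw [Finset.mem_filter, map_add]
    simp
  · intro h _ h' _ hh
    exact Subtype.ext (add_left_cancel hh)
  · intro x hx
    have hx' : -a + x ∈ H := QuotientAddGroup.eq.1 (Finset.mem_filter.1 hx).2.symm
    exact ⟨⟨-a + x, hx'⟩, Finset.mem_univ _, by simp⟩

theorem sum_comp_mk (H : AddSubgroup G) [Fintype (G ⧸ H)] (F : G ⧸ H → ℕ) :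
    ∑ x : G, F (QuotientAddGroup.mk' H x) = Nat.card H * ∑ q, F q := by
  classical
  rw [← Finset.sum_fiberwise univ (QuotientAddGroup.mk' H), Finset.mul_sum]
  refine Finset.sum_congr rfl fun q _ => ?_
  rw [← card_fiber_mk H q, Finset.card_eq_sum_ones, Finset.sum_mul]
  refine Finset.sum_congr rfl fun x hx => ?_
  rw [(Finset.mem_filter.1 hx).2, one_mul]

theorem card_cl (H : AddSubgroup G) [DecidableEq (G ⧸ H)] (E : Finset G) :
    (cl H E).card = Nat.card H * (E.image (QuotientAddGroup.mk' H)).card := by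
  have : Fintype (G ⧸ H) := Fintype.ofFinite _
  have h1 := sum_comp_mk H fun q => if q ∈ E.image (QuotientAddGroup.mk' H) then 1 else 0
  rw [Finset.sum_boole, Finset.sum_boole] at h1
  simp only [Nat.cast_id] at h1
  rw [Finset.filter_univ_mem] at h1
  rw [← h1]
  congr 1
  ext x
  simp only [mem_cl, Finset.mem_filter, Finset.mem_univ, true_and, Finset.mem_image]
  refine exists_congr fun e => and_congr_right fun _ => ?_
  rw [← neg_add_eq_sub]
  exact QuotientAddGroup.eq.symm

theorem IsPer.card_eq {H : AddSubgroup G} [DecidableEq (G ⧸ H)] {Y : Finset G} (h : IsPer H Y) :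
    Y.card = Nat.card H * (Y.image (QuotientAddGroup.mk' H)).card := by
  rw [← card_cl, h.cl_eq]

open Classical in
/-- The number of terms of `S` in the coset `x + H`. -/
noncomputable def mult (H : AddSubgroup G) (x : G) (S : Multiset G) : ℕ :=
  S.countP fun s => x - s ∈ H

theorem mult_eq_count (H : AddSubgroup G) [DecidableEq (G ⧸ H)] (x : G) (S : Multiset G) :
    mult H x S = (S.map (QuotientAddGroup.mk' H)).count (QuotientAddGroup.mk' H x) := by
  classical
  rw [mult, Multiset.count, Multiset.countP_map, ← Multiset.countP_eq_card_filter]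
  refine Multiset.countP_congr rfl fun s _ => ?_
  rw [eq_iff_iff, ← neg_add_eq_sub, eq_comm]
  exact QuotientAddGroup.eq.symm

theorem mult_bot (x : G) (S : Multiset G) : mult ⊥ x S = S.count x := by
  classical
  rw [mult, Multiset.count]
  refine Multiset.countP_congr rfl fun s _ => ?_
  simp [sub_eq_zero]

theorem mult_add (H : AddSubgroup G) (x : G) (S T : Multiset G) :
    mult H x (S + T) = mult H x S + mult H x T := by
  classical
  unfold mult
  exact Multiset.countP_add _ _ _

theorem mult_mono (H : AddSubgroup G) (x : G) {S T : Multiset G} (h : S ≤ T) :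
    mult H x S ≤ mult H x T := by
  classical
  unfold mult
  exact Multiset.countP_le_of_le _ h

theorem mult_le_of_le {H K : AddSubgroup G} (h : K ≤ H) (x : G) (S : Multiset G) :
    mult K x S ≤ mult H x S := by
  classical
  rw [mult, mult, Multiset.countP_eq_card_filter, Multiset.countP_eq_card_filter]
  exact Multiset.card_le_card (Multiset.monotone_filter_right S fun s hs => h hs)

end Finite

/-! ### Kneser's theorem: slices, holes and convergents -/

section Kneser

variable {G : Type u} [AddCommGroup G] [Fintype G] [DecidableEq G]

open Classical in
/-- The coset `p + H` as a finite set. -/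
noncomputable def coset (H : AddSubgroup G) (p : G) : Finset G := cl H {p}

theorem mem_coset {H : AddSubgroup G} {p x : G} : x ∈ coset H p ↔ x - p ∈ H := by
  simp [coset, mem_cl]

theorem card_coset (H : AddSubgroup G) (p : G) : (coset H p).card = Nat.card H := by
  classical
  rw [coset, card_cl, Finset.image_singleton, Finset.card_singleton, mul_one]

/-- Two subsets of cosets of `H` whose sumset misses an element of the sum of the cosets are
small. -/
theorem card_add_card_le_of_notMem {H : AddSubgroup G} {X W : Finset G} {p q z : G}
    (hX : ∀ x ∈ X, x - p ∈ H) (hW : ∀ w ∈ W, w - q ∈ H) (hz : z - (p + q) ∈ H)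
    (h : z ∉ X + W) : X.card + W.card ≤ Nat.card H := by
  have hd : Disjoint X (W.image fun w => z - w) := by
    rw [Finset.disjoint_left]
    intro x hx hx'
    obtain ⟨w, hw, rfl⟩ := Finset.mem_image.1 hx'
    exact h (Finset.mem_add.2 ⟨_, hx, w, hw, by abel⟩)
  rw [← card_coset H p, ← Finset.card_image_of_injective W (sub_right_injective (b := z)),
    ← Finset.card_union_of_disjoint hd]
  refine Finset.card_le_card (Finset.union_subset (fun x hx => mem_coset.2 (hX x hx)) ?_)
  intro x hx
  obtain ⟨w, hw, rfl⟩ := Finset.mem_image.1 hx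
  refine mem_coset.2 ?_
  have := H.sub_mem hz (hW w hw)
  convert this using 1
  abel

open Classical in
/-- The part of `E` in the coset `p + H`. -/
noncomputable def slice (H : AddSubgroup G) (p : G) (E : Finset G) : Finset G :=
  E.filter fun x => x - p ∈ H

theorem mem_slice {H : AddSubgroup G} {p x : G} {E : Finset G} :
    x ∈ slice H p E ↔ x ∈ E ∧ x - p ∈ H := by
  simp [slice]

theorem slice_union (H : AddSubgroup G) (p : G) (E F : Finset G) :
    slice H p (E ∪ F) = slice H p E ∪ slice H p F := by
  simp [slice, Finset.filter_union]

theorem slice_congr {H : AddSubgroup G} {p q : G} (h : p - q ∈ H) (E : Finset G) :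
    slice H p E = slice H q E := by
  ext x
  rw [mem_slice, mem_slice, ← H.add_mem_cancel_right h]
  simp

theorem cl_inter_coset {H L : AddSubgroup G} (hL : L ≤ H) (p : G) (E : Finset G) :
    cl L E ∩ coset H p ⊆ cl L (slice H p E) := by
  intro x hx
  rw [Finset.mem_inter, mem_coset] at hx
  obtain ⟨e, he, hxe⟩ := mem_cl.1 hx.1
  refine mem_cl.2 ⟨e, mem_slice.2 ⟨he, ?_⟩, hxe⟩
  have := H.sub_mem hx.2 (hL hxe)
  convert this using 1
  abel

theorem coset_subset_cl {H : AddSubgroup G} {p : G} {E : Finset G} (hp : p ∈ E) :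
    coset H p ⊆ cl H E := fun _ hx => mem_cl.2 ⟨p, hp, mem_coset.1 hx⟩

/-- `cl H E` fills the coset `p + H`, where `cl L E` has only the closure of the slice; elsewhere
the latter is contained in the former. -/
theorem card_add_card_cl_le {H L : AddSubgroup G} (hL : L ≤ H) {p : G} {E : Finset G}
    (hp : p ∈ E) :
    Nat.card H + (cl L E).card ≤ (cl H E).card + (cl L (slice H p E)).card := by
  have h1 := Finset.card_sdiff_add_card_inter (cl L E) (coset H p)
  have h2 := Finset.card_le_card (cl_inter_coset hL p E)
  have h3 : ((cl L E \ coset H p) ∪ coset H p).card ≤ (cl H E).card :=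
    Finset.card_le_card (Finset.union_subset
      (Finset.sdiff_subset.trans (cl_mono_left hL E)) (coset_subset_cl hp))
  rw [Finset.card_union_of_disjoint Finset.sdiff_disjoint, card_coset] at h3
  omega

theorem two_mul_card_add_card_cl_le {H L : AddSubgroup G} (hL : L ≤ H) {p q : G} {E : Finset G}
    (hp : p ∈ E) (hq : q ∈ E) (hpq : p - q ∉ H) :
    2 * Nat.card H + (cl L E).card ≤
      (cl H E).card + (cl L (slice H p E)).card + (cl L (slice H q E)).card := by
  have hd : Disjoint (coset H p) (coset H q) := by
    rw [Finset.disjoint_left]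
    intro x hx hx'
    rw [mem_coset] at hx hx'
    apply hpq
    have := H.sub_mem hx' hx
    convert this using 1
    abel
  have h1 := Finset.card_sdiff_add_card_inter (cl L E) (coset H p ∪ coset H q)
  have h2 : (cl L E ∩ (coset H p ∪ coset H q)).card ≤
      (cl L (slice H p E)).card + (cl L (slice H q E)).card := by
    rw [Finset.inter_union_distrib_left]
    exact (Finset.card_union_le _ _).trans (add_le_add
      (Finset.card_le_card (cl_inter_coset hL p E)) (Finset.card_le_card (cl_inter_coset hL q E)))
  have h3 : ((cl L E \ (coset H p ∪ coset H q)) ∪ (coset H p ∪ coset H q)).card ≤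
      (cl H E).card :=
    Finset.card_le_card (Finset.union_subset (Finset.sdiff_subset.trans (cl_mono_left hL E))
      (Finset.union_subset (coset_subset_cl hp) (coset_subset_cl hq)))
  rw [Finset.card_union_of_disjoint Finset.sdiff_disjoint, Finset.card_union_of_disjoint hd,
    card_coset, card_coset] at h3
  omega

/-- One half of the counting in a grid of cosets of two subgroups. -/
theorem card_mul_card_le_card_mul_card_sdiff {K K' : AddSubgroup G} {D D' : Finset G}
    (hD : IsPer K D) (hD' : IsPer K' D') (z : G) (R Q : Finset G)
    (hR : ∀ x ∈ R, x ∈ K' ∧ z + x ∉ D) (hQ : ∀ x ∈ Q, x ∈ K ∧ z + x ∈ D') :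
    R.card * Q.card ≤ Nat.card (K ⊓ K' : AddSubgroup G) * (D' \ D).card := by
  classical
  rw [← Finset.card_product]
  refine Finset.card_le_mul_card_image_of_maps_to (f := fun x : G × G => z + x.1 + x.2) ?_ _ ?_
  · rintro ⟨x, y⟩ hxy
    rw [Finset.mem_product] at hxy
    obtain ⟨hx, hx'⟩ := hR x hxy.1
    obtain ⟨hy, hy'⟩ := hQ y hxy.2
    refine Finset.mem_sdiff.2 ⟨?_, fun hmem => hx' ?_⟩
    · exact hD'.of_sub_mem hy' (by simpa [add_sub_add_right_eq_sub, add_right_comm] using hx)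
    · exact hD.of_sub_mem hmem (by simpa using hy)
  · intro w _
    by_cases hne : ((R ×ˢ Q).filter fun x : G × G => z + x.1 + x.2 = w).Nonempty
    · obtain ⟨⟨x0, y0⟩, h0⟩ := hne
      simp only [Finset.mem_filter, Finset.mem_product] at h0
      rw [← card_coset (K ⊓ K' : AddSubgroup G) x0]
      -- All admissible `x` agree modulo `K ⊓ K'`, and `w` together with `x` determines `y`.
      refine Finset.card_le_card_of_injOn (fun x => x.1) ?_ ?_
      · rintro ⟨x, y⟩ hxy
        simp only [Finset.coe_filter, Finset.mem_product, Set.mem_ofPred_eq] at hxy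
        refine mem_coset.2 (AddSubgroup.mem_inf.2 ⟨?_, ?_⟩)
        · have : x - x0 = y0 - y := by
            have := hxy.2.trans h0.2.symm
            rw [add_assoc, add_assoc] at this
            have := add_left_cancel this
            rw [sub_eq_sub_iff_add_eq_add, this, add_comm]
          rw [this]
          exact K.sub_mem (hQ _ h0.1.2).1 (hQ _ hxy.1.2).1
        · exact K'.sub_mem (hR _ hxy.1.1).1 (hR _ h0.1.1).1
      · rintro ⟨x, y⟩ hxy ⟨x', y'⟩ hxy' hxx
        simp only [Finset.coe_filter, Finset.mem_product, Set.mem_ofPred_eq] at hxy hxy' hxx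
        subst hxx
        have := hxy.2.trans hxy'.2.symm
        rw [add_left_cancel this]
    · rw [Finset.not_nonempty_iff_eq_empty.1 hne]
      simp

/-- (a − m)(b − m) ≥ 0 and ab ≤ md give m(a + b) ≤ m(d + m). -/
theorem sub_le_of_mul_le {m a b d : ℕ} (hm : 0 < m) (hma : m ≤ a) (hmb : m ≤ b) {c : ℕ}
    (hac : a ≤ c) (h : c * b ≤ m * d) : a + b ≤ d + m := by
  have h1 : a * b ≤ m * d := (Nat.mul_le_mul_right b hac).trans h
  nlinarith [Nat.mul_le_mul hma hmb]

theorem card_filter_add_card_filter_not (K : AddSubgroup G) (p : G → Prop)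
    [DecidablePred fun x => x ∈ K ∧ p x] [DecidablePred fun x => x ∈ K ∧ ¬ p x] :
    (univ.filter fun x => x ∈ K ∧ p x).card + (univ.filter fun x => x ∈ K ∧ ¬ p x).card =
      Nat.card K := by
  classical
  rw [← card_coset K 0, ← Finset.card_union_of_disjoint]
  · congr 1
    ext x
    simp only [Finset.mem_union, Finset.mem_filter, Finset.mem_univ, true_and, mem_coset, sub_zero]
    tauto
  · rw [Finset.disjoint_left]
    intro x hx hx'
    exact (Finset.mem_filter.1 hx').2.2 (Finset.mem_filter.1 hx).2.2

/-- Kneser's bound for the union of two periodic sets that share a hole. -/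
theorem min_card_add_card_le_card_union {K K' : AddSubgroup G} {D D' : Finset G}
    (hD : IsPer K D) (hD' : IsPer K' D') {z : G} (hz : z ∉ D) (hz' : z ∉ D')
    (h : ∃ k ∈ K, z + k ∈ D') (h' : ∃ k ∈ K', z + k ∈ D) :
    min (D.card + Nat.card K) (D'.card + Nat.card K') ≤
      (D ∪ D').card + Nat.card (K ⊓ K' : AddSubgroup G) := by
  classical
  obtain ⟨k, hk, hkD'⟩ := h
  obtain ⟨k', hk', hkD⟩ := h'
  set M : AddSubgroup G := K ⊓ K' with hM
  have key : ∀ (p : G) (X : Finset G), coset M p ⊆ X → Nat.card M ≤ X.card := by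
    intro p X hX
    rw [← card_coset M p]
    exact Finset.card_le_card hX
  have hin : ∀ {p x : G}, x ∈ coset M p → x - p ∈ K ∧ x - p ∈ K' := by
    intro p x hx
    exact AddSubgroup.mem_inf.1 (mem_coset.1 hx)
  -- In the grid z + K' + K, the points z + R + Q' lie in D' \ D and z + Q + R' in D \ D'. Each of
  -- the four sets contains a coset of M.
  set R := univ.filter fun x => x ∈ K' ∧ ¬ z + x ∈ D with hR
  set R' := univ.filter fun x => x ∈ K' ∧ z + x ∈ D with hR'
  set Q := univ.filter fun x => x ∈ K ∧ ¬ z + x ∈ D' with hQ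
  set Q' := univ.filter fun x => x ∈ K ∧ z + x ∈ D' with hQ'
  have c1 : R'.card + R.card = Nat.card K' := card_filter_add_card_filter_not K' _
  have c2 : Q'.card + Q.card = Nat.card K := card_filter_add_card_filter_not K _
  have m1 : Nat.card M ≤ R.card := by
    refine key 0 _ fun x hx => ?_
    obtain ⟨h1, h2⟩ := hin hx
    rw [sub_zero] at h1 h2
    rw [hR, Finset.mem_filter]
    refine ⟨Finset.mem_univ _, h2, fun hh => hz (hD.of_sub_mem hh ?_)⟩
    simpa using h1
  have m2 : Nat.card M ≤ Q.card := by
    refine key 0 _ fun x hx => ?_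
    obtain ⟨h1, h2⟩ := hin hx
    rw [sub_zero] at h1 h2
    rw [hQ, Finset.mem_filter]
    refine ⟨Finset.mem_univ _, h1, fun hh => hz' (hD'.of_sub_mem hh ?_)⟩
    simpa using h2
  have m3 : Nat.card M ≤ R'.card := by
    refine key k' _ fun x hx => ?_
    obtain ⟨h1, h2⟩ := hin hx
    rw [hR', Finset.mem_filter]
    refine ⟨Finset.mem_univ _, ?_, hD.of_sub_mem hkD (by simpa using h1)⟩
    simpa using K'.add_mem h2 hk'
  have m4 : Nat.card M ≤ Q'.card := by
    refine key k _ fun x hx => ?_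
    obtain ⟨h1, h2⟩ := hin hx
    rw [hQ', Finset.mem_filter]
    refine ⟨Finset.mem_univ _, ?_, hD'.of_sub_mem hkD' (by simpa using h2)⟩
    simpa using K.add_mem h1 hk
  have hm : 0 < Nat.card M := Nat.card_pos
  have e1 := card_mul_card_le_card_mul_card_sdiff hD hD' z R Q'
    (fun x hx => (Finset.mem_filter.1 hx).2) (fun x hx => (Finset.mem_filter.1 hx).2)
  have e2 := card_mul_card_le_card_mul_card_sdiff hD' hD z Q R'
    (fun x hx => (Finset.mem_filter.1 hx).2) (fun x hx => (Finset.mem_filter.1 hx).2)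
  rw [inf_comm] at e2
  have u1 : (D ∪ D').card = D.card + (D' \ D).card := by
    rw [← Finset.union_sdiff_self_eq_union, Finset.card_union_of_disjoint Finset.disjoint_sdiff]
  have u2 : (D ∪ D').card = D'.card + (D \ D').card := by
    rw [Finset.union_comm, ← Finset.union_sdiff_self_eq_union,
      Finset.card_union_of_disjoint Finset.disjoint_sdiff]
  -- If |Q| ≤ |R|, then |K| = |Q| + |Q'| ≤ |D' \ D| + |M|; the other case is dual.
  rcases le_total Q.card R.card with hle | hle
  · have := sub_le_of_mul_le hm m2 m4 hle e1
    exact (min_le_left _ _).trans (by omega)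
  · have := sub_le_of_mul_le hm m1 m3 hle e2
    exact (min_le_right _ _).trans (by omega)

/-- Kneser's theorem for the pair `A`, `B`, in terms of the stabilizer of `A + B`. -/
def KneserBound (A B : Finset G) : Prop :=
  (cl (stab (A + B)) A).card + (cl (stab (A + B)) B).card ≤
    (A + B).card + Nat.card (stab (A + B))

/-- A periodic subset of `A + B` that is large enough relative to its period. -/
structure Convergent (A B : Finset G) (H : AddSubgroup G) (C : Finset G) : Prop where
  subset : C ⊆ A + B
  nonempty : C.Nonempty
  isPer : IsPer H C
  card_le : (A ∩ B).card + (cl H (A ∪ B)).card ≤ C.card + Nat.card H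

/-- The hole `z` keeps the `H`-periodic set `C` out of `y + H`, so `C` and `D` are disjoint. The
last hypothesis is what `D` must contribute when the period drops to `L`. -/
theorem Convergent.extend {A B C D : Finset G} {H L : AddSubgroup G} (hC : Convergent A B H C)
    (hL : L ≤ H) {y z : G} (hz : z ∉ A + B) (hzy : z - y ∈ H) (hD : D ⊆ A + B)
    (hper : IsPer L D) (hDy : ∀ d ∈ D, d - y ∈ H)
    (h : Nat.card H + (cl L (A ∪ B)).card ≤ D.card + Nat.card L + (cl H (A ∪ B)).card) :
    Convergent A B L (C ∪ D) := by
  refine ⟨Finset.union_subset hC.subset hD, hC.nonempty.mono Finset.subset_union_left,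
    (hC.isPer.mono hL).union hper, ?_⟩
  have hd : Disjoint C D := by
    rw [Finset.disjoint_left]
    intro x hx hxD
    refine hz (hC.subset (hC.isPer.of_sub_mem hx ?_))
    have := H.sub_mem hzy (hDy x hxD)
    convert this using 1
    abel
  rw [Finset.card_union_of_disjoint hd]
  have := hC.card_le
  omega

theorem slice_add_slice_sub_mem {A B : Finset G} {H : AddSubgroup G} {a b d : G}
    (hd : d ∈ slice H a A + slice H b B) : d - (a + b) ∈ H := by
  obtain ⟨x, hx, w, hw, rfl⟩ := Finset.mem_add.1 hd
  have := H.add_mem (mem_slice.1 hx).2 (mem_slice.1 hw).2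
  convert this using 1
  abel

theorem slice_add_slice_subset {A B : Finset G} {H : AddSubgroup G} {a b : G} :
    slice H a A + slice H b B ⊆ A + B :=
  Finset.add_subset_add (fun _ hx => (mem_slice.1 hx).1) (fun _ hx => (mem_slice.1 hx).1)

/-- The stabilizer of a sumset of slices with a hole lies properly below `H`. -/
theorem stab_slice_lt {A B : Finset G} {H : AddSubgroup G} {a b z : G}
    (hne : (slice H a A + slice H b B).Nonempty) (hz : z ∉ A + B) (hza : z - (a + b) ∈ H) :
    stab (slice H a A + slice H b B) < H := by
  obtain ⟨d, hd⟩ := hne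
  have hle : stab (slice H a A + slice H b B) ≤ H := by
    intro k hk
    have := H.sub_mem (slice_add_slice_sub_mem (hk d hd)) (slice_add_slice_sub_mem hd)
    convert this using 1
    abel
  refine lt_of_le_of_ne hle fun heq => hz (slice_add_slice_subset (H := H) (a := a) (b := b) ?_)
  refine (isPer_stab _).of_sub_mem hd ?_
  rw [heq]
  have := H.sub_mem hza (slice_add_slice_sub_mem hd)
  convert this using 1
  abel

/-- If the closed slices are large, every point of the coset is reached up to the period. -/
theorem exists_add_mem_of_lt_card {H K : AddSubgroup G} (hK : K ≤ H) {A B : Finset G} {a b z : G}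
    (hz : z - (a + b) ∈ H)
    (h : Nat.card H < (cl K (slice H a A)).card + (cl K (slice H b B)).card) :
    ∃ k ∈ K, z + k ∈ slice H a A + slice H b B := by
  have hsl : ∀ (p : G) (E : Finset G), ∀ x ∈ cl K (slice H p E), x - p ∈ H := by
    intro p E x hx
    obtain ⟨e, he, hxe⟩ := mem_cl.1 hx
    have := H.add_mem (hK hxe) (mem_slice.1 he).2
    convert this using 1
    abel
  by_contra hcon
  refine absurd (card_add_card_le_of_notMem (hsl a A) (hsl b B) hz fun hmem => hcon ?_)
    (not_le.2 h)
  obtain ⟨x, hx, w, hw, rfl⟩ := Finset.mem_add.1 hmem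
  obtain ⟨x', hx', hxx⟩ := mem_cl.1 hx
  obtain ⟨w', hw', hww⟩ := mem_cl.1 hw
  refine ⟨-((x - x') + (w - w')), K.neg_mem (K.add_mem hxx hww), ?_⟩
  have : x + w + -((x - x') + (w - w')) = x' + w' := by abel
  rw [this]
  exact Finset.add_mem_add hx' hw'

theorem card_cl_union_le (L : AddSubgroup G) (E F : Finset G) :
    (cl L (E ∪ F)).card ≤ (cl L E).card + (cl L F).card := by
  rw [cl_union]
  exact Finset.card_union_le _ _

/-- By aperiodicity some coset a + b + H meeting A + B has a hole. It can receive the sum of the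
slices of A at a and B at b, the crossed sum (A at b, B at a), or both; Kneser's bound for slices
controls their sizes. -/
theorem Convergent.exists_lt {A B C : Finset G} {H : AddSubgroup G} (hC : Convergent A B H C)
    (hap : Aper (A + B)) (hH : H ≠ ⊥)
    (ih : ∀ a b : G, (slice H a A).Nonempty → (slice H b B).Nonempty →
      (slice H a A + slice H b B).card < (A + B).card →
      KneserBound (slice H a A) (slice H b B)) :
    ∃ L < H, ∃ C', Convergent A B L C' := by
  obtain ⟨h, hh, hh0⟩ : ∃ h ∈ H, h ≠ 0 := by
    by_contra hcon
    push Not at hcon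
    exact hH ((AddSubgroup.eq_bot_iff_forall H).2 hcon)
  have : ∃ y ∈ A + B, (h : G) + y ∉ A + B := by
    by_contra hcon
    push Not at hcon
    exact hh0 (hap _ hcon)
  obtain ⟨y, hy, hz⟩ := this
  obtain ⟨a, ha, b, hb, rfl⟩ := Finset.mem_add.1 hy
  set z := (h : G) + (a + b) with hzdef
  have hzy : z - (a + b) ∈ H := by simpa [hzdef] using hh
  have hzy' : z - (b + a) ∈ H := by rwa [add_comm b a]
  have haE : a ∈ A ∪ B := Finset.mem_union_left _ ha
  have hbE : b ∈ A ∪ B := Finset.mem_union_right _ hb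
  obtain ⟨c, hc⟩ := hC.nonempty
  have hsmall : ∀ p q : G, z - (p + q) ∈ H →
      (slice H p A + slice H q B).card < (A + B).card := by
    intro p q hpq
    refine Finset.card_lt_card (Finset.ssubset_iff_subset_ne.2 ⟨slice_add_slice_subset, ?_⟩)
    intro heq
    refine hz (hC.subset (hC.isPer.of_sub_mem hc ?_))
    have hcm : c ∈ slice H p A + slice H q B := heq ▸ hC.subset hc
    have := H.sub_mem hpq (slice_add_slice_sub_mem hcm)
    convert this using 1
    abel
  have haA : a ∈ slice H a A := mem_slice.2 ⟨ha, by simp⟩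
  have hbB : b ∈ slice H b B := mem_slice.2 ⟨hb, by simp⟩
  have hDne : (slice H a A + slice H b B).Nonempty := ⟨_, Finset.add_mem_add haA hbB⟩
  have hk1 := ih a b ⟨a, haA⟩ ⟨b, hbB⟩ (hsmall a b hzy)
  have hlt1 := stab_slice_lt hDne hz hzy
  rw [KneserBound] at hk1
  set A1 := slice H a A with hA1
  set B1 := slice H b B with hB1
  set A2 := slice H b A with hA2
  set B2 := slice H a B with hB2
  set D := A1 + B1 with hDdef
  set K := stab D with hK
  have hEa : slice H a (A ∪ B) = A1 ∪ B2 := slice_union _ _ _ _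
  have hEb : slice H b (A ∪ B) = A2 ∪ B1 := slice_union _ _ _ _
  have first : Nat.card H + (cl K (A ∪ B)).card ≤
      (cl K A1).card + (cl K B1).card + (cl H (A ∪ B)).card →
      ∃ L < H, ∃ C', Convergent A B L C' := by
    intro hle
    refine ⟨K, hlt1, C ∪ D, hC.extend hlt1.le hz hzy slice_add_slice_subset (isPer_stab _)
      (fun d hd => slice_add_slice_sub_mem hd) (by omega)⟩
  have cnta := fun L (hL : L ≤ H) => card_add_card_cl_le (E := A ∪ B) hL haE
  have cntb := fun L (hL : L ≤ H) => card_add_card_cl_le (E := A ∪ B) hL hbE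
  rw [hEa] at cnta
  rw [hEb] at cntb
  have u1 := fun L => card_cl_union_le L A1 B2
  have u2 := fun L => card_cl_union_le L A2 B1
  by_cases hab : a - b ∈ H
  · have hBB : B2 = B1 := slice_congr hab B
    have h1 := cnta K hlt1.le
    have h2 := u1 K
    rw [hBB] at h2 h1
    exact first (by omega)
  rcases Finset.eq_empty_or_nonempty A2 with hA2e | hA2n
  · have h1 := cntb K hlt1.le
    rw [hA2e, Finset.empty_union] at h1
    exact first (by omega)
  rcases Finset.eq_empty_or_nonempty B2 with hB2e | hB2n
  · have h1 := cnta K hlt1.le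
    rw [hB2e, Finset.union_empty] at h1
    exact first (by omega)
  have cnt2 := fun L (hL : L ≤ H) => two_mul_card_add_card_cl_le (E := A ∪ B) hL haE hbE hab
  rw [hEa, hEb] at cnt2
  by_cases hs1 : (cl K A2).card + (cl K B2).card ≤ Nat.card H
  · have h1 := cnt2 K hlt1.le
    have h2 := u1 K
    have h3 := u2 K
    exact first (by omega)
  have hDne' : (A2 + B2).Nonempty := hA2n.add hB2n
  have hk2 := ih b a hA2n hB2n (hsmall b a hzy')
  have hlt2 := stab_slice_lt hDne' hz hzy'
  rw [KneserBound, ← hA2, ← hB2] at hk2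
  rw [← hA2, ← hB2] at hlt2
  set D' := A2 + B2 with hDdef'
  set K' := stab D' with hK'
  have hD'y : ∀ d ∈ D', d - (a + b) ∈ H := by
    intro d hd
    rw [add_comm a b]
    exact slice_add_slice_sub_mem hd
  by_cases hs2 : (cl K' A1).card + (cl K' B1).card ≤ Nat.card H
  · have h1 := cnt2 K' hlt2.le
    have h2 := u1 K'
    have h3 := u2 K'
    exact ⟨K', hlt2, C ∪ D', hC.extend hlt2.le hz hzy slice_add_slice_subset (isPer_stab _)
      hD'y (by omega)⟩
  -- Neither `D` nor `D'` is known to suffice alone. The failed bounds put points of `D'` in z + K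
  -- and of `D` in z + K', which is what the union bound needs.
  have hex : ∃ k ∈ K, z + k ∈ D' := exists_add_mem_of_lt_card hlt1.le hzy' (not_le.1 hs1)
  have hex' : ∃ k ∈ K', z + k ∈ D := exists_add_mem_of_lt_card hlt2.le hzy (not_le.1 hs2)
  have hzD : z ∉ D := fun hm => hz (slice_add_slice_subset hm)
  have hzD' : z ∉ D' := fun hm => hz (slice_add_slice_subset hm)
  set M : AddSubgroup G := K ⊓ K' with hM
  have hmin : min (D.card + Nat.card K) (D'.card + Nat.card K') ≤ (D ∪ D').card + Nat.card M :=
    min_card_add_card_le_card_union (isPer_stab D) (isPer_stab D') hzD hzD' hex hex'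
  have hMK : M ≤ K := inf_le_left
  have hMK' : M ≤ K' := inf_le_right
  -- Otherwise `z` differs from a point of `D` by an element of M ≤ K, a period of `D`.
  have pig1 : (cl M A1).card + (cl M B1).card ≤ Nat.card H := by
    by_contra hcon
    obtain ⟨k, hk, hkD⟩ := exists_add_mem_of_lt_card (hMK.trans hlt1.le) hzy (not_le.1 hcon)
    exact hzD ((isPer_stab D).of_sub_mem hkD (by simpa using K.neg_mem (hMK hk)))
  have pig2 : (cl M A2).card + (cl M B2).card ≤ Nat.card H := by
    by_contra hcon
    obtain ⟨k, hk, hkD⟩ := exists_add_mem_of_lt_card (hMK.trans hlt1.le) hzy' (not_le.1 hcon)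
    exact hzD' ((isPer_stab D').of_sub_mem hkD (by simpa using K'.neg_mem (hMK' hk)))
  have c1 := Finset.card_le_card (cl_mono_left hMK A1)
  have c2 := Finset.card_le_card (cl_mono_left hMK B1)
  have c3 := Finset.card_le_card (cl_mono_left hMK' A2)
  have c4 := Finset.card_le_card (cl_mono_left hMK' B2)
  have h1 := cnt2 M (hMK.trans hlt1.le)
  have h2 := u1 M
  have h3 := u2 M
  refine ⟨M, lt_of_le_of_lt hMK hlt1, C ∪ (D ∪ D'), hC.extend (hMK.trans hlt1.le) hz hzy
    (Finset.union_subset slice_add_slice_subset slice_add_slice_subset)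
    (((isPer_stab D).mono hMK).union ((isPer_stab D').mono hMK')) ?_ ?_⟩
  · intro d hd
    rcases Finset.mem_union.1 hd with hd | hd
    · exact slice_add_slice_sub_mem hd
    · exact hD'y d hd
  · rcases min_le_iff.1 hmin with hm | hm <;> omega

end Kneser

/-! ### Kneser's theorem: the induction -/

/-- The aperiodic case is applied modulo the stabilizer, where the measure does not grow, and
multiplied back. Hence the induction hypothesis ranges over all groups. -/
theorem KneserBound.of_aper {N : ℕ}
    (ih : ∀ (G : Type u) [AddCommGroup G] [Fintype G] [DecidableEq G] (A B : Finset G),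
      A.Nonempty → B.Nonempty → (A + B).card + A.card ≤ N → Aper (A + B) →
      A.card + B.card ≤ (A + B).card + 1)
    {G : Type u} [AddCommGroup G] [Fintype G] [DecidableEq G] {A B : Finset G}
    (hA : A.Nonempty) (hB : B.Nonempty) (hN : (A + B).card + A.card ≤ N) : KneserBound A B := by
  classical
  have : Fintype (G ⧸ stab (A + B)) := Fintype.ofFinite _
  have himg := Finset.image_add (QuotientAddGroup.mk' (stab (A + B))) (s := A) (t := B)
  have h1 := ih (G ⧸ stab (A + B)) (A.image (QuotientAddGroup.mk' (stab (A + B))))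
    (B.image (QuotientAddGroup.mk' (stab (A + B)))) (hA.image _) (hB.image _)
    (by
      rw [← himg]
      exact (add_le_add Finset.card_image_le Finset.card_image_le).trans hN)
    (by
      rw [← himg]
      exact aper_image_stab _)
  rw [← himg] at h1
  rw [KneserBound, card_cl, card_cl, (isPer_stab (A + B)).card_eq, ← mul_add, ← Nat.mul_succ]
  exact Nat.mul_le_mul_left _ h1

theorem Convergent.exists_bot {G : Type u} [AddCommGroup G] [Fintype G] [DecidableEq G]
    {A B : Finset G} (hap : Aper (A + B))
    (ih : ∀ (H : AddSubgroup G) (a b : G), (slice H a A).Nonempty → (slice H b B).Nonempty →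
      (slice H a A + slice H b B).card < (A + B).card →
      KneserBound (slice H a A) (slice H b B)) (H : AddSubgroup G) :
    ∀ C, Convergent A B H C → ∃ C', Convergent A B ⊥ C' := by
  induction H using WellFoundedLT.induction with
  | ind H hind =>
    intro C hC
    by_cases hH : H = ⊥
    · exact ⟨C, hH ▸ hC⟩
    · obtain ⟨L, hL, C', hC'⟩ := hC.exists_lt hap hH (ih H)
      exact hind L hL C' hC'

theorem kneser_aux (N : ℕ) :
    ∀ (G : Type u) [AddCommGroup G] [Fintype G] [DecidableEq G] (A B : Finset G),
      A.Nonempty → B.Nonempty → (A + B).card + A.card ≤ N → Aper (A + B) →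
      A.card + B.card ≤ (A + B).card + 1 := by
  induction N with
  | zero =>
    intro G _ _ _ A B hA hB hN
    have := hA.card_pos
    omega
  | succ N ih =>
    intro G _ _ _ A B hA hB hN hap
    have hrel : ∀ X Y : Finset G, X.Nonempty → Y.Nonempty → (X + Y).card + X.card ≤ N →
        KneserBound X Y := fun X Y hX hY h => KneserBound.of_aper ih hX hY h
    -- The pair (A ∩ B, A ∪ B) has the same total size, a smaller measure and a sumset inside A + B;
    -- that sumset is the initial convergent.
    have core : ∀ B : Finset G, (A + B).card + A.card ≤ N + 1 → Aper (A + B) →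
        (A ∩ B).Nonempty → (A ∩ B).card < A.card → A.card + B.card ≤ (A + B).card + 1 := by
      intro B hN hap hne hlt
      have hsub : (A ∩ B) + (A ∪ B) ⊆ A + B := by
        intro x hx
        obtain ⟨p, hp, q, hq, rfl⟩ := Finset.mem_add.1 hx
        obtain ⟨hp1, hp2⟩ := Finset.mem_inter.1 hp
        rcases Finset.mem_union.1 hq with hq | hq
        · rw [add_comm p q]
          exact Finset.add_mem_add hq hp2
        · exact Finset.add_mem_add hp1 hq
      have hne' : (A ∪ B).Nonempty := hA.mono Finset.subset_union_left
      have h0 := hrel (A ∩ B) (A ∪ B) hne hne' (by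
        have := Finset.card_le_card hsub
        omega)
      have hC : Convergent A B (stab ((A ∩ B) + (A ∪ B))) ((A ∩ B) + (A ∪ B)) := by
        refine ⟨hsub, hne.add hne', isPer_stab _, le_trans ?_ h0⟩
        exact Nat.add_le_add_right (Finset.card_le_card (subset_cl _ _)) _
      obtain ⟨C, hC⟩ := Convergent.exists_bot hap (fun H a b ha hb hlt => hrel _ _ ha hb (by
        have : (slice H a A).card ≤ A.card :=
          Finset.card_le_card fun x hx => (mem_slice.1 hx).1
        omega)) _ _ hC
      have h1 := hC.card_le
      have h2 := Finset.card_le_card hC.subset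
      rw [cl_bot, AddSubgroup.card_bot] at h1
      have h3 := Finset.card_union_add_card_inter A B
      omega
    rcases hA.exists_eq_singleton_or_nontrivial with ⟨a, rfl⟩ | ⟨a, ha, a', ha', hne⟩
    · rw [Finset.singleton_add, Finset.card_vadd_finset, Finset.card_singleton, add_comm]
    -- As `a - a'` is not a period of B, some translate of B contains `a'` but not `a`.
    · have : ∃ b ∈ B, a - a' + b ∉ B := by
        by_contra hcon
        push Not at hcon
        exact hne (sub_eq_zero.1 (hap.of_add_right _ hcon))
      obtain ⟨b, hb, hb'⟩ := this
      set B' := B.image fun x => a' - b + x with hB'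
      have hinj : Function.Injective fun x : G => a' - b + x := add_right_injective _
      have hcard : B'.card = B.card := Finset.card_image_of_injective _ hinj
      have hAB : A + B' = (A + B).image fun x => a' - b + x := by
        ext x
        simp only [hB', Finset.mem_add, Finset.mem_image]
        constructor
        · rintro ⟨p, hp, _, ⟨q, hq, rfl⟩, rfl⟩
          exact ⟨_, ⟨p, hp, q, hq, rfl⟩, by abel⟩
        · rintro ⟨_, ⟨p, hp, q, hq, rfl⟩, rfl⟩
          exact ⟨p, hp, _, ⟨q, hq, rfl⟩, by abel⟩
      have hABcard : (A + B').card = (A + B).card := by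
        rw [hAB, Finset.card_image_of_injective _ hinj]
      have hap' : Aper (A + B') := by
        intro x hx
        apply hap
        intro y hy
        rw [hAB] at hx
        obtain ⟨w, hw, hwx⟩ := Finset.mem_image.1 (hx _ (Finset.mem_image_of_mem _ hy))
        have : w = x + y := by
          apply hinj
          exact hwx.trans (add_left_comm _ _ _)
        exact this ▸ hw
      have haB' : a ∉ B' := by
        intro hmem
        obtain ⟨x, hx, hxa⟩ := Finset.mem_image.1 hmem
        apply hb'
        have : a - a' + b = x := by
          rw [← hxa]
          abel
        exact this ▸ hx
      have ha'B' : a' ∈ B' := Finset.mem_image.2 ⟨b, hb, by abel⟩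
      have := core B' (by omega) hap' ⟨a', Finset.mem_inter.2 ⟨ha', ha'B'⟩⟩
        (Finset.card_lt_card (Finset.ssubset_iff_subset_ne.2 ⟨Finset.inter_subset_left,
          fun heq => haB' (Finset.mem_inter.1 (heq.symm ▸ ha : a ∈ A ∩ B')).2⟩))
      omega

/-- Kneser's theorem for aperiodic sumsets in a finite abelian group. -/
theorem Aper.card_add_card_le {G : Type u} [AddCommGroup G] [Fintype G] [DecidableEq G]
    {A B : Finset G} (h : Aper (A + B)) (hA : A.Nonempty) (hB : B.Nonempty) :
    A.card + B.card ≤ (A + B).card + 1 :=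
  kneser_aux _ G A B hA hB le_rfl h

theorem Aper.sum_card_le {G : Type u} [AddCommGroup G] [Fintype G] [DecidableEq G]
    {ι : Type*} [DecidableEq ι] (J : Finset ι) (D : ι → Finset G) (hD : ∀ j, (D j).Nonempty) :
    Aper (∑ j ∈ J, D j) →
      1 + ∑ j ∈ J, (D j).card ≤ (∑ j ∈ J, D j).card + J.card ∧ (∑ j ∈ J, D j).Nonempty := by
  induction J using Finset.induction_on with
  | empty => simp
  | insert i J hi ih =>
    intro h
    rw [Finset.sum_insert hi] at h ⊢
    obtain ⟨h1, h2⟩ := ih h.of_add_right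
    have h3 := h.card_add_card_le (hD i) h2
    rw [Finset.sum_insert hi, Finset.card_insert_of_notMem hi]
    exact ⟨by omega, (hD i).add h2⟩

/-! ### Sums with a prescribed number of terms in each class -/

section Blocks

variable {G : Type u} [AddCommGroup G] [DecidableEq G] {ι : Type*} [DecidableEq ι]

theorem filter_mem_insert {α : Type*} (f : α → ι) (S : Multiset α) {j : ι} {J : Finset ι}
    (hj : j ∉ J) : S.filter (fun s => f s ∈ insert j J) =
      S.filter (fun s => f s = j) + S.filter (fun s => f s ∈ J) := by
  rw [Multiset.filter_add_filter]
  have h1 : S.filter (fun s => f s = j ∧ f s ∈ J) = 0 := by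
    rw [Multiset.filter_eq_nil]
    rintro s _ ⟨rfl, hs⟩
    exact hj hs
  rw [h1, add_zero]
  simp only [Finset.mem_insert]

theorem exists_of_mem_sum_sums (f : G → ι) (S : Multiset G) (i : ι → ℕ) (J : Finset ι) :
    ∀ y ∈ ∑ j ∈ J, sums (i j) (S.filter fun s => f s = j),
      ∃ U ≤ S.filter (fun s => f s ∈ J), Multiset.card U = ∑ j ∈ J, i j ∧ U.sum = y := by
  induction J using Finset.induction_on with
  | empty =>
    intro y hy
    exact ⟨0, Multiset.zero_le _, by simp, by simpa [eq_comm] using hy⟩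
  | insert j J hj ih =>
    intro y hy
    rw [Finset.sum_insert hj] at hy ⊢
    obtain ⟨p, hp, q, hq, rfl⟩ := Finset.mem_add.1 hy
    obtain ⟨U, hU, hUc, rfl⟩ := mem_sums.1 hp
    obtain ⟨V, hV, hVc, rfl⟩ := ih q hq
    refine ⟨U + V, ?_, by rw [Multiset.card_add, hUc, hVc], Multiset.sum_add _ _⟩
    rw [filter_mem_insert f S hj]
    exact add_le_add hU hV

theorem sum_filter_mem_sum_sums (f : G → ι) {S U : Multiset G} (hU : U ≤ S) (J : Finset ι) :
    (U.filter fun s => f s ∈ J).sum ∈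
        ∑ j ∈ J, sums (Multiset.card (U.filter fun s => f s = j)) (S.filter fun s => f s = j) ∧
      Multiset.card (U.filter fun s => f s ∈ J) =
        ∑ j ∈ J, Multiset.card (U.filter fun s => f s = j) := by
  induction J using Finset.induction_on with
  | empty => simp
  | insert j J hj ih =>
    rw [Finset.sum_insert hj, Finset.sum_insert hj, filter_mem_insert f U hj, Multiset.sum_add,
      Multiset.card_add, ih.2]
    exact ⟨Finset.add_mem_add (mem_sums.2 ⟨_, Multiset.filter_le_filter _ hU, rfl, rfl⟩) ih.1, rfl⟩

theorem map_of_mem_sum_sums {G' : Type*} [AddCommGroup G'] [DecidableEq G'] (f : G →+ G')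
    (S : Multiset G) (i : G' → ℕ) (J : Finset G') :
    ∀ y ∈ ∑ j ∈ J, sums (i j) (S.filter fun s => f s = j), f y = ∑ j ∈ J, i j • j := by
  induction J using Finset.induction_on with
  | empty =>
    intro y hy
    have : y = 0 := by simpa using hy
    simp [this]
  | insert j J hj ih =>
    intro y hy
    rw [Finset.sum_insert hj] at hy ⊢
    obtain ⟨p, hp, q, hq, rfl⟩ := Finset.mem_add.1 hy
    obtain ⟨U, hU, hUc, rfl⟩ := mem_sums.1 hp
    have h1 : U.map f = Multiset.replicate (i j) j := by
      rw [Multiset.eq_replicate, Multiset.card_map]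
      refine ⟨hUc, fun b hb => ?_⟩
      obtain ⟨x, hx, rfl⟩ := Multiset.mem_map.1 hb
      exact (Multiset.mem_filter.1 (Multiset.mem_of_le hU hx)).2
    rw [map_add, ih q hq, map_multiset_sum, h1, Multiset.sum_replicate]

theorem image_sum_finset {G' : Type*} [AddCommGroup G'] [DecidableEq G'] (f : G →+ G')
    (J : Finset ι) (D : ι → Finset G) :
    (∑ j ∈ J, D j).image f = ∑ j ∈ J, (D j).image f := by
  induction J using Finset.induction_on with
  | empty =>
    simp
    rfl
  | insert j J hj ih => rw [Finset.sum_insert hj, Finset.sum_insert hj, Finset.image_add, ih]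

end Blocks

/-! ### Weights for the DeVos–Goddyn–Mohar descent -/

section Weights

variable {G : Type u} [AddCommGroup G] [Fintype G] [DecidableEq G]

theorem count_le_mult {H : AddSubgroup G} {x a : G} (h : x - a ∈ H) (S : Multiset G) :
    S.count a ≤ mult H x S := by
  classical
  unfold mult
  rw [Multiset.count, Multiset.countP_eq_card_filter, Multiset.countP_eq_card_filter]
  refine Multiset.card_le_card (Multiset.monotone_filter_right S fun s hs => ?_)
  rw [← hs]
  exact h

theorem mult_eq_zero {H : AddSubgroup G} {x : G} {A : Finset G} (h : x ∉ cl H A) :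
    mult H x A.val = 0 := by
  classical
  unfold mult
  rw [Multiset.countP_eq_zero]
  exact fun a ha hxa => h (mem_cl.2 ⟨a, ha, hxa⟩)

theorem one_le_mult {H : AddSubgroup G} {x : G} {A : Finset G} (h : x ∈ cl H A) :
    1 ≤ mult H x A.val := by
  obtain ⟨a, ha, hxa⟩ := mem_cl.1 h
  exact (Multiset.one_le_count_iff_mem.2 ha).trans (count_le_mult hxa _)

/-- The contribution of `x` to the lower bound for sums of one term from `A` and `r` terms from
`S`, relative to the subgroup `H`. -/
noncomputable def weight (r : ℕ) (A : Finset G) (S : Multiset G) (H : AddSubgroup G) (x : G) : ℕ :=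
  (if x ∈ cl H A then 1 else 0) + min r (mult H x S)

theorem sum_weight (r : ℕ) (A : Finset G) (S : Multiset G) (H : AddSubgroup G) :
    ∑ x, weight r A S H x = (cl H A).card + ∑ x, min r (mult H x S) := by
  simp only [weight, Finset.sum_add_distrib, Finset.sum_boole, Finset.filter_univ_mem,
    Nat.cast_id]

/-- This is the pointwise cost of shrinking `H` to `L`, with `i` the number of selected terms in x +
H. The last summand compensates for the cap `r` when i = r + 1 and x lies outside `cl H A`. -/
theorem weight_add_le {r : ℕ} {A : Finset G} {S : Multiset G} (hA : ∀ a ∈ A, r ≤ S.count a)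
    {H L : AddSubgroup G} (hL : L ≤ H) (x : G) {i : ℕ} (hi : i ≤ mult H x (S + A.val))
    (hir : i ≤ r + 1) :
    weight r A S L x + i ≤
      weight r A S H x + min i (mult L x (S + A.val)) + if i = r + 1 then 1 else 0 := by
  have h1 := mult_add H x S A.val
  have h2 := mult_add L x S A.val
  have h3 := mult_le_of_le hL x S
  unfold weight
  by_cases hxL : x ∈ cl L A
  · have hxH := cl_mono_left hL A hxL
    have h4 := one_le_mult hxL
    have h5 : ∀ {K : AddSubgroup G}, x ∈ cl K A → r ≤ mult K x S := fun hx => by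
      obtain ⟨a, ha, hxa⟩ := mem_cl.1 hx
      exact (hA a ha).trans (count_le_mult hxa S)
    have h6 := h5 hxL
    have h7 := h5 hxH
    rw [if_pos hxL, if_pos hxH]
    split_ifs <;> omega
  · rw [if_neg hxL]
    have h4 := mult_eq_zero hxL
    by_cases hxH : x ∈ cl H A
    · rw [if_pos hxH]
      obtain ⟨a, ha, hxa⟩ := mem_cl.1 hxH
      have h5 := (hA a ha).trans (count_le_mult hxa S)
      split_ifs <;> omega
    · rw [if_neg hxH]
      have h5 := mult_eq_zero hxH
      split_ifs <;> omega

/-- A periodic subset of `Y` that is large with respect to the weights. -/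
structure Large (r : ℕ) (A : Finset G) (S : Multiset G) (Y : Finset G) (H : AddSubgroup G)
    (C : Finset G) : Prop where
  subset : C ⊆ Y
  nonempty : C.Nonempty
  isPer : IsPer H C
  le_card : ∑ x, weight r A S H x ≤ C.card + r * Nat.card H

end Weights

/-- The aperiodic case of the bound for `|Σ_r(S)|`, for `|S| + r ≤ N`. -/
def SubsumBound (N : ℕ) : Prop :=
  ∀ (G : Type u) [AddCommGroup G] [Fintype G] [DecidableEq G] (S : Multiset G) (r : ℕ),
    Multiset.card S + r ≤ N → r ≤ Multiset.card S → Aper (sums r S) →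
      1 + ∑ g, min r (S.count g) ≤ (sums r S).card + r

/-! ### The DeVos–Goddyn–Mohar inequality -/

section Step

variable {G : Type u} [AddCommGroup G] [Fintype G] [DecidableEq G]

theorem SubsumBound.relative {N : ℕ} (ih : SubsumBound.{u} N) {S : Multiset G} {r : ℕ}
    (hN : Multiset.card S + r ≤ N) (hr : r ≤ Multiset.card S) (L : AddSubgroup G)
    [DecidableEq (G ⧸ L)] (hap : Aper ((sums r S).image (QuotientAddGroup.mk' L))) :
    Nat.card L + ∑ x, min r (mult L x S) ≤
      Nat.card L * ((sums r S).image (QuotientAddGroup.mk' L)).card + r * Nat.card L := by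
  have : Fintype (G ⧸ L) := Fintype.ofFinite _
  rw [image_sums] at hap ⊢
  have h1 := ih (G ⧸ L) (S.map (QuotientAddGroup.mk' L)) r (by rwa [Multiset.card_map])
    (by rwa [Multiset.card_map]) hap
  have h2 := sum_comp_mk L fun q => min r ((S.map (QuotientAddGroup.mk' L)).count q)
  simp only [← mult_eq_count] at h2
  rw [h2, mul_comm r, ← mul_add]
  have h3 := Nat.mul_le_mul_left (Nat.card L) h1
  rwa [mul_add, mul_one] at h3

theorem SubsumBound.exists_large {N : ℕ} (ih : SubsumBound.{u} N) {S : Multiset G} {r : ℕ}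
    {A : Finset G} (hA : ∀ a ∈ A, r ≤ S.count a) (hne : S + A.val ≠ 0)
    (hN : Multiset.card (S + A.val) + r ≤ N) (hr : r + 1 ≤ Multiset.card (S + A.val)) :
    ∃ H C, Large r A S (sums (r + 1) (S + A.val)) H C := by
  classical
  -- If A is empty, one term `u` is fixed. Deleting it costs at most 1 at each point of one coset of
  -- the stabilizer, which the summand `Nat.card L` of `SubsumBound.relative` pays for. If not,
  -- Kneser's theorem handles A + Σ_r(S).
  rcases Finset.eq_empty_or_nonempty A with rfl | hAne
  · obtain ⟨u, hu⟩ := Multiset.exists_mem_of_ne_zero hne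
    simp only [Finset.empty_val, add_zero] at hu hN hr ⊢
    have hc := Multiset.card_erase_of_mem hu
    have hpos := Multiset.card_pos_iff_exists_mem.2 ⟨u, hu⟩
    rw [Nat.pred_eq_sub_one] at hc
    set X := sums r (S.erase u) with hX
    have h1 := ih.relative (S := S.erase u) (r := r) (by omega) (by omega) (stab X)
      (aper_image_stab X)
    rw [← hX, ← (isPer_stab X).card_eq] at h1
    refine ⟨stab X, X.image fun y => u + y, ?_, ?_, ?_, ?_⟩
    · intro y hy
      obtain ⟨w, hw, rfl⟩ := Finset.mem_image.1 hy
      obtain ⟨U, hU, hUc, rfl⟩ := mem_sums.1 hw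
      refine mem_sums.2 ⟨u ::ₘ U, ?_, by simp [hUc], by simp⟩
      rw [← Multiset.cons_erase hu]
      exact Multiset.cons_le_cons u hU
    · exact (sums_nonempty (by omega)).image _
    · intro h hh y hy
      obtain ⟨w, hw, rfl⟩ := Finset.mem_image.1 hy
      exact Finset.mem_image.2 ⟨h + w, hh w hw, add_left_comm _ _ _⟩
    · rw [Finset.card_image_of_injective _ (add_right_injective u), sum_weight, cl_empty,
        Finset.card_empty, zero_add]
      refine le_trans ?_ h1
      rw [← card_coset (stab X) u, Finset.card_eq_sum_ones, ← Finset.sum_filter_add_sum_filter_not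
        univ (· ∈ coset (stab X) u) fun x => min r (mult (stab X) x S),
        ← Finset.sum_filter_add_sum_filter_not
        univ (· ∈ coset (stab X) u) fun x => min r (mult (stab X) x (S.erase u)),
        Finset.filter_univ_mem, ← add_assoc, ← Finset.sum_add_distrib]
      have hmul : ∀ x, mult (stab X) x S =
          mult (stab X) x (S.erase u) + mult (stab X) x {u} := by
        intro x
        rw [← mult_add, add_comm, Multiset.singleton_add, Multiset.cons_erase hu]
      refine add_le_add (Finset.sum_le_sum fun x hx => ?_) (Finset.sum_le_sum fun x hx => ?_)
      · have := hmul x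
        have h2 : mult (stab X) x {u} ≤ 1 := by
          unfold mult
          exact (Multiset.countP_le_card _ _).trans (by simp)
        omega
      · have := hmul x
        have h2 : mult (stab X) x {u} = 0 := by
          unfold mult
          rw [Multiset.countP_eq_zero]
          intro a ha hxa
          rw [Multiset.mem_singleton.1 ha] at hxa
          exact (Finset.mem_filter.1 hx).2 (mem_coset.2 hxa)
        omega
  · obtain ⟨a, ha⟩ := hAne
    have hcS : r ≤ Multiset.card S := (hA a ha).trans (Multiset.count_le_card _ _)
    set X := sums r S with hX
    have hXne : X.Nonempty := sums_nonempty hcS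
    have hadd := Finset.image_add (QuotientAddGroup.mk' (stab (A + X))) (s := A) (t := X)
    have hap := aper_image_stab (A + X)
    rw [hadd] at hap
    rw [Multiset.card_add] at hN
    have h1 := ih.relative (S := S) (r := r) (by omega) hcS (stab (A + X)) hap.of_add_right
    have h2 := hap.card_add_card_le (Finset.Nonempty.image ⟨a, ha⟩ _) (hXne.image _)
    rw [← hadd] at h2
    refine ⟨stab (A + X), A + X, ?_, Finset.Nonempty.add ⟨a, ha⟩ hXne, isPer_stab _, ?_⟩
    · intro y hy
      obtain ⟨b, hb, w, hw, rfl⟩ := Finset.mem_add.1 hy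
      obtain ⟨U, hU, hUc, rfl⟩ := mem_sums.1 hw
      refine mem_sums.2 ⟨b ::ₘ U, ?_, by simp [hUc], by simp⟩
      rw [← Multiset.singleton_add, add_comm]
      exact add_le_add hU (Multiset.singleton_le.2 hb)
    · rw [sum_weight, card_cl, (isPer_stab (A + X)).card_eq]
      have h3 := Nat.mul_le_mul_left (Nat.card (stab (A + X))) h2
      rw [mul_add, mul_add, mul_one] at h3
      rw [← hX] at h1
      omega

/-- Modulo `stab D` every block is aperiodic, being a summand of an aperiodic sumset. The induction
hypothesis bounds each block and Kneser's theorem adds the bounds up. -/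
theorem SubsumBound.card_blocks {N : ℕ} (ih : SubsumBound.{u} N) {T U : Multiset G}
    (hU : U ≤ T) (H : AddSubgroup G) [DecidableEq (G ⧸ H)] [Fintype (G ⧸ H)] {D : Finset G}
    (hD : D = ∑ q, sums (Multiset.card (U.filter fun s => QuotientAddGroup.mk' H s = q))
      (T.filter fun s => QuotientAddGroup.mk' H s = q))
    (hN : ∀ q, Multiset.card (T.filter fun s => QuotientAddGroup.mk' H s = q) +
      Multiset.card (U.filter fun s => QuotientAddGroup.mk' H s = q) ≤ N)
    (hL : stab D ≤ H) :
    Nat.card (stab D) + ∑ x, min (mult H x U) (mult (stab D) x T) ≤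
      D.card + Multiset.card U * Nat.card (stab D) := by
  classical
  have : Fintype (G ⧸ stab D) := Fintype.ofFinite _
  set φ := QuotientAddGroup.mk' (stab D) with hφ
  set i := fun q => Multiset.card (U.filter fun s => QuotientAddGroup.mk' H s = q) with hi
  set B := fun q => T.filter fun s => QuotientAddGroup.mk' H s = q with hB
  have hiB : ∀ q, i q ≤ Multiset.card (B q) := fun q =>
    Multiset.card_le_card (Multiset.filter_le_filter _ hU)
  have himg : D.image φ = ∑ q, (sums (i q) (B q)).image φ := by
    rw [← image_sum_finset]
    exact congrArg _ hD
  have hap : Aper (D.image φ) := aper_image_stab D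
  have h1 := Aper.sum_card_le univ (fun q => (sums (i q) (B q)).image φ)
    (fun q => (sums_nonempty (hiB q)).image _) (himg ▸ hap)
  have h2 : ∀ q, Nat.card (stab D) + ∑ x, min (i q) (mult (stab D) x (B q)) ≤
      Nat.card (stab D) * ((sums (i q) (B q)).image φ).card + i q * Nat.card (stab D) := by
    intro q
    refine ih.relative (hN q) (hiB q) (stab D) ?_
    rw [himg, ← Finset.add_sum_erase _ _ (Finset.mem_univ q)] at hap
    exact hap.of_add_left
  have h3 := Finset.sum_le_sum fun q (_ : q ∈ univ) => h2 q
  have hcard := (sum_filter_mem_sum_sums (QuotientAddGroup.mk' H) hU univ).2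
  simp only [Finset.mem_univ, Multiset.filter_true] at hcard
  rw [Finset.sum_add_distrib, Finset.sum_add_distrib, ← Finset.mul_sum, ← Finset.sum_mul,
    ← hcard, Finset.sum_const, smul_eq_mul, Finset.sum_comm] at h3
  have h4 : ∑ x, min (mult H x U) (mult (stab D) x T) ≤
      ∑ x, ∑ q, min (i q) (mult (stab D) x (B q)) := by
    refine Finset.sum_le_sum fun x _ => ?_
    refine le_trans (le_of_eq ?_) (Finset.single_le_sum
      (f := fun q => min (i q) (mult (stab D) x (B q))) (fun _ _ => Nat.zero_le _)
      (Finset.mem_univ (QuotientAddGroup.mk' H x)))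
    have e0 : ∀ s, (QuotientAddGroup.mk' H s = QuotientAddGroup.mk' H x) ↔ x - s ∈ H := by
      intro s
      rw [← neg_add_eq_sub]
      exact QuotientAddGroup.eq
    congr 1
    · simp only [hi, mult, e0, Multiset.countP_eq_card_filter]
    · simp only [hB, mult, e0, Multiset.countP_filter]
      refine Multiset.countP_congr rfl fun s _ => ?_
      rw [eq_iff_iff]
      exact ⟨fun h => ⟨h, hL h⟩, fun h => h.1⟩
  have h5 := Nat.mul_le_mul_left (Nat.card (stab D)) h1.1
  rw [← himg, mul_add, mul_add, ← (isPer_stab D).card_eq, mul_one, Finset.card_univ] at h5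
  rw [Finset.card_univ, mul_comm (Fintype.card _)] at h3
  omega

/-- Let y = σ(U) have a hole in its `H`-coset. The sums using as many terms as U from each `H`-coset
form a set D inside y + H, a coset that `C` avoids; C ∪ D is the new large set. -/
theorem Large.exists_lt {N : ℕ} (ih : SubsumBound.{u} N) {S : Multiset G} {r : ℕ}
    {A : Finset G} (hA : ∀ a ∈ A, r ≤ S.count a)
    (hN : Multiset.card (S + A.val) + (r + 1) ≤ N + 1)
    (hap : Aper (sums (r + 1) (S + A.val))) {H : AddSubgroup G} {C : Finset G}
    (hC : Large r A S (sums (r + 1) (S + A.val)) H C) (hH : H ≠ ⊥) :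
    ∃ L < H, ∃ C', Large r A S (sums (r + 1) (S + A.val)) L C' := by
  classical
  have : Fintype (G ⧸ H) := Fintype.ofFinite _
  set T := S + A.val with hT
  set Y := sums (r + 1) T with hY
  obtain ⟨h, hh, hh0⟩ : ∃ h ∈ H, h ≠ 0 := by
    by_contra hcon
    push Not at hcon
    exact hH ((AddSubgroup.eq_bot_iff_forall H).2 hcon)
  obtain ⟨y, hy, hz⟩ : ∃ y ∈ Y, h + y ∉ Y := by
    by_contra hcon
    push Not at hcon
    exact hh0 (hap _ hcon)
  obtain ⟨U, hU, hUc, hUy⟩ := mem_sums.1 hy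
  set π := QuotientAddGroup.mk' H with hπ
  set D := ∑ q, sums (Multiset.card (U.filter fun s => π s = q)) (T.filter fun s => π s = q)
    with hD
  have hUD := sum_filter_mem_sum_sums π hU univ
  simp only [Finset.mem_univ, Multiset.filter_true] at hUD
  obtain ⟨hyD, hcard⟩ := hUD
  rw [hUy, ← hD] at hyD
  have hDY : D ⊆ Y := by
    intro d hd
    obtain ⟨V, hV, hVc, hVd⟩ := exists_of_mem_sum_sums π T _ univ d hd
    rw [← hcard] at hVc
    exact mem_sums.2 ⟨V, hV.trans (Multiset.filter_le _ _), hVc.trans hUc, hVd⟩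
  have hDcos : ∀ d ∈ D, d - y ∈ H := by
    intro d hd
    have h1 := map_of_mem_sum_sums π T _ univ d hd
    have h2 := map_of_mem_sum_sums π T _ univ y hyD
    rw [← QuotientAddGroup.eq_zero_iff]
    change π (d - y) = 0
    rw [map_sub, h1, h2, sub_self]
  have hLH : stab D ≤ H := by
    intro l hl
    have := hDcos _ (hl y hyD)
    simpa using this
  have hlt : stab D < H := by
    refine lt_of_le_of_ne hLH fun heq => hz (hDY ?_)
    exact (isPer_stab D) h (heq ▸ hh) y hyD
  have hCy : ∀ c ∈ C, c - y ∉ H := by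
    intro c hc hcy
    refine hz (hC.subset (hC.isPer.of_sub_mem hc ?_))
    have := H.sub_mem hh hcy
    convert this using 1
    abel
  have hdisj : Disjoint C D := Finset.disjoint_left.2 fun c hc hcD => hCy c hc (hDcos c hcD)
  -- Otherwise all of T lies in one `H`-coset, so all sums of r + 1 terms do, whereas `C` misses the
  -- coset of `y`.
  have hNq : ∀ q, Multiset.card (T.filter fun s => π s = q) +
      Multiset.card (U.filter fun s => π s = q) ≤ N := by
    intro q
    have h1 := Multiset.card_le_card (Multiset.filter_le (fun s => π s = q) T)
    have h2 := Multiset.card_le_card (Multiset.filter_le (fun s => π s = q) U)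
    by_contra hcon
    have h3 : T.filter (fun s => π s = q) = T :=
      Multiset.eq_of_le_of_card_le (Multiset.filter_le _ _) (by omega)
    obtain ⟨c, hc⟩ := hC.nonempty
    obtain ⟨V, hV, hVc, rfl⟩ := mem_sums.1 (hC.subset hc)
    have key : ∀ W ≤ T, π W.sum = Multiset.card W • q := by
      intro W hW
      have : W.map π = Multiset.replicate (Multiset.card W) q := by
        rw [Multiset.eq_replicate, Multiset.card_map]
        refine ⟨rfl, fun b hb => ?_⟩
        obtain ⟨x, hx, rfl⟩ := Multiset.mem_map.1 hb
        have hxT := Multiset.mem_of_le hW hx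
        rw [← h3] at hxT
        exact (Multiset.mem_filter.1 hxT).2
      rw [map_multiset_sum, this, Multiset.sum_replicate]
    apply hCy _ hc
    rw [← QuotientAddGroup.eq_zero_iff]
    change π (V.sum - y) = 0
    rw [map_sub, ← hUy, key V hV, key U hU, hVc, hUc, sub_self]
  have hblock := ih.card_blocks hU H hD hNq hLH
  refine ⟨stab D, hlt, C ∪ D, Finset.union_subset hC.subset hDY,
    hC.nonempty.mono Finset.subset_union_left, (hC.isPer.mono hLH).union (isPer_stab D), ?_⟩
  rw [Finset.card_union_of_disjoint hdisj]
  have hle := hC.le_card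
  have hpt := Finset.sum_le_sum fun x (_ : x ∈ univ) => weight_add_le hA hLH x
    (mult_mono H x hU) ((by
      rw [← hUc]
      unfold mult
      exact Multiset.countP_le_card _ _) : mult H x U ≤ r + 1)
  rw [Finset.sum_add_distrib, Finset.sum_add_distrib, Finset.sum_add_distrib] at hpt
  have hsumU : ∑ x, mult H x U = Nat.card H * (r + 1) := by
    have h1 := sum_comp_mk H fun q => (U.map (QuotientAddGroup.mk' H)).count q
    simp only [← mult_eq_count] at h1
    rw [h1, Multiset.sum_count_eq_card fun a _ => Finset.mem_univ a, Multiset.card_map, hUc]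
  obtain ⟨u, hu⟩ := Multiset.card_pos_iff_exists_mem.1 (by omega : 0 < Multiset.card U)
  -- The correction occurs only if all of U lies in x + H.
  have hone : ∑ x, (if mult H x U = r + 1 then 1 else 0) ≤ Nat.card H := by
    rw [Finset.sum_boole, Nat.cast_id, ← card_coset H u]
    refine Finset.card_le_card fun x hx => mem_coset.2 ?_
    have h1 := (Finset.mem_filter.1 hx).2
    unfold mult at h1
    rw [← hUc, Multiset.countP_eq_card] at h1
    exact h1 u hu
  rw [hUc] at hblock
  rw [hsumU] at hpt
  rw [← hT] at hpt
  have e1 : (r + 1) * Nat.card (stab D) = r * Nat.card (stab D) + Nat.card (stab D) := by ring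
  have e2 : Nat.card H * (r + 1) = r * Nat.card H + Nat.card H := by ring
  omega

theorem Large.exists_bot {N : ℕ} (ih : SubsumBound.{u} N) {S : Multiset G} {r : ℕ}
    {A : Finset G} (hA : ∀ a ∈ A, r ≤ S.count a)
    (hN : Multiset.card (S + A.val) + (r + 1) ≤ N + 1)
    (hap : Aper (sums (r + 1) (S + A.val))) (H : AddSubgroup G) :
    ∀ C, Large r A S (sums (r + 1) (S + A.val)) H C →
      ∃ C', Large r A S (sums (r + 1) (S + A.val)) ⊥ C' := by
  induction H using WellFoundedLT.induction with
  | ind H hind =>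
    intro C hC
    by_cases hH : H = ⊥
    · exact ⟨C, hH ▸ hC⟩
    · obtain ⟨L, hL, C', hC'⟩ := hC.exists_lt ih hA hN hap hH
      exact hind L hL C' hC'

end Step

theorem subsumBound (N : ℕ) : SubsumBound.{u} N := by
  induction N with
  | zero =>
    intro G _ _ _ S r hN hr _
    have h1 : Multiset.card S = 0 := by omega
    have h2 : r = 0 := by omega
    have h3 := (sums_nonempty hr).card_pos
    subst h2
    simpa using h3
  | succ N ih =>
    intro G _ _ _ T r hN hr hap
    rcases r with _ | r
    · have h3 := (sums_nonempty hr).card_pos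
      simpa using h3
    -- With one copy of each such value split off, the indicator of A raises the cap from r to r + 1
    -- in the weight at `⊥`.
    · set A := T.toFinset.filter fun g => r + 1 ≤ T.count g with hAdef
      have hAT : A.val ≤ T := by
        rw [Multiset.le_iff_count]
        intro a
        by_cases ha : a ∈ A
        · rw [Multiset.count_eq_one_of_mem A.nodup ha]
          exact le_trans (by omega) (Finset.mem_filter.1 ha).2
        · rw [Multiset.count_eq_zero_of_notMem ha]
          exact Nat.zero_le _
      obtain ⟨S, hS⟩ := Multiset.le_iff_exists_add.1 hAT
      rw [add_comm] at hS
      have hcount : ∀ g, T.count g = S.count g + A.val.count g := by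
        intro g
        rw [hS, Multiset.count_add]
      have hA : ∀ a ∈ A, r ≤ S.count a := by
        intro a ha
        have h1 := hcount a
        rw [Multiset.count_eq_one_of_mem A.nodup ha] at h1
        have h2 := (Finset.mem_filter.1 ha).2
        omega
      rw [hS] at hN hr hap
      have hne : S + A.val ≠ 0 := by
        intro h0
        rw [h0] at hr
        simp at hr
      obtain ⟨H, C, hC⟩ := ih.exists_large hA hne (by omega) hr
      obtain ⟨C, hC⟩ := Large.exists_bot ih hA hN hap H C hC
      have h1 := hC.le_card
      have h2 := Finset.card_le_card hC.subset
      rw [AddSubgroup.card_bot, mul_one] at h1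
      have h3 : ∑ g, min (r + 1) (T.count g) ≤ ∑ x, weight r A S ⊥ x := by
        refine Finset.sum_le_sum fun g _ => ?_
        rw [weight, cl_bot, mult_bot, hcount g]
        by_cases hg : g ∈ A
        · rw [if_pos hg, Multiset.count_eq_one_of_mem A.nodup hg]
          omega
        · rw [if_neg hg, Multiset.count_eq_zero_of_notMem hg]
          have : T.count g ≤ r := by
            by_contra hcon
            refine hg (Finset.mem_filter.2 ⟨?_, by omega⟩)
            rw [Multiset.mem_toFinset, ← Multiset.count_pos]
            omega
          have h4 := hcount g
          rw [Multiset.count_eq_zero_of_notMem hg] at h4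
          omega
      rw [← hS] at h2
      omega

/-- The DeVos–Goddyn–Mohar bound for sequences, in the aperiodic case. -/
theorem Aper.sum_min_count_le {G : Type u} [AddCommGroup G] [Fintype G] [DecidableEq G]
    {S : Multiset G} {r : ℕ} (hr : r ≤ Multiset.card S) (h : Aper (sums r S)) :
    1 + ∑ g, min r (S.count g) ≤ (sums r S).card + r :=
  subsumBound _ G S r le_rfl hr h

/-! ### Sums of at most r terms -/

section BoundedSubsums

variable {G : Type u} [AddCommGroup G] [DecidableEq G]

/-- The sums of the subsequences of length at most `r`. -/
def lsum (r : ℕ) (T : Multiset G) : Finset G :=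
  ((T.powerset.filter fun U => Multiset.card U ≤ r).map Multiset.sum).toFinset

theorem mem_lsum {r : ℕ} {T : Multiset G} {y : G} :
    y ∈ lsum r T ↔ ∃ U ≤ T, Multiset.card U ≤ r ∧ U.sum = y := by
  simp only [lsum, Multiset.mem_toFinset, Multiset.mem_map, Multiset.mem_filter,
    Multiset.mem_powerset, and_assoc]

theorem zero_mem_lsum (r : ℕ) (T : Multiset G) : 0 ∈ lsum r T :=
  mem_lsum.2 ⟨0, Multiset.zero_le _, by simp, by simp⟩

theorem lsum_erase_subset (r : ℕ) (T : Multiset G) (g : G) :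
    lsum r (T.erase g) ⊆ lsum (r + 1) T := by
  intro y hy
  obtain ⟨U, hU, hc, rfl⟩ := mem_lsum.1 hy
  exact mem_lsum.2 ⟨U, hU.trans (Multiset.erase_le g T), by omega, rfl⟩

theorem add_mem_lsum {r : ℕ} {T : Multiset G} {g y : G} (hg : g ∈ T)
    (hy : y ∈ lsum r (T.erase g)) : g + y ∈ lsum (r + 1) T := by
  obtain ⟨U, hU, hc, rfl⟩ := mem_lsum.1 hy
  refine mem_lsum.2 ⟨g ::ₘ U, ?_, by simpa using hc, by simp⟩
  rw [← Multiset.cons_erase hg]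
  exact Multiset.cons_le_cons g hU

theorem sum_erase_notMem_lsum {r : ℕ} {T : Multiset G} {g : G} (hg : g ∈ T)
    (h : T.sum ∉ lsum (r + 1) T) : (T.erase g).sum ∉ lsum r (T.erase g) := by
  intro hmem
  apply h
  rw [← Multiset.cons_erase hg, Multiset.sum_cons, Multiset.cons_erase hg]
  exact add_mem_lsum hg hmem

theorem lt_card_of_sum_notMem {r : ℕ} {T : Multiset G} (h : T.sum ∉ lsum r T) :
    r < Multiset.card T := by
  by_contra hcon
  exact h (mem_lsum.2 ⟨T, le_rfl, by omega, rfl⟩)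

theorem sum_mem_lsum {r : ℕ} {A B : Finset G} (hB : B ⊆ A) (hc : B.card ≤ r) :
    ∑ b ∈ B, b ∈ lsum r A.val := by
  refine mem_lsum.2 ⟨B.val, Finset.val_le_iff.2 hB, hc, ?_⟩
  rw [Finset.sum, Multiset.map_id']

theorem lsum_one (T : Multiset G) : lsum 1 T = insert 0 T.toFinset := by
  ext y
  rw [mem_lsum, Finset.mem_insert, Multiset.mem_toFinset]
  constructor
  · rintro ⟨U, hU, hc, rfl⟩
    rcases Nat.le_one_iff_eq_zero_or_eq_one.1 hc with hc | hc
    · left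
      rw [Multiset.card_eq_zero.1 hc, Multiset.sum_zero]
    · obtain ⟨a, rfl⟩ := Multiset.card_eq_one.1 hc
      right
      rw [Multiset.sum_singleton]
      exact Multiset.singleton_le.1 hU
  · rintro (rfl | hy)
    · exact ⟨0, Multiset.zero_le _, by simp, by simp⟩
    · exact ⟨{y}, Multiset.singleton_le.2 hy, by simp, by simp⟩

end BoundedSubsums

/-! ### Translations with a single exit -/

section Exits

variable {G : Type u} [AddCommGroup G] [DecidableEq G]

/-- The elements of `Y` that translation by `x` moves out of `Y`. -/
def exits (Y : Finset G) (x : G) : Finset G := Y.filter fun y => x + y ∉ Y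

theorem mem_exits {Y : Finset G} {x y : G} : y ∈ exits Y x ↔ y ∈ Y ∧ x + y ∉ Y := by
  simp [exits]

theorem card_exits_neg (Y : Finset G) (x : G) : (exits Y (-x)).card = (exits Y x).card := by
  have h1 : (Y.filter fun y => -x + y ∈ Y).card = (Y.filter fun y => x + y ∈ Y).card := by
    refine Finset.card_bij' (fun y _ => -x + y) (fun y _ => x + y) ?_ ?_ ?_ ?_ <;>
      simp +contextual
  have h2 := Finset.card_filter_add_card_filter_not (s := Y) fun y => -x + y ∈ Y
  have h3 := Finset.card_filter_add_card_filter_not (s := Y) fun y => x + y ∈ Y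
  unfold exits
  omega

/-- Exchange relation between two translations with a single exit. -/
theorem exits_exchange {Y : Finset G} (hap : Aper Y) {x y p q : G} (hx : exits Y x = {p})
    (hy : exits Y y = {q}) (hx0 : x ≠ 0) (hy0 : y ≠ 0) (hxy : x + y ≠ 0) :
    x + p = y + q ∨ p = q := by
  have hxe : ∀ z ∈ Y, x + z ∉ Y → z = p := fun z hz hz' => by
    rw [← Finset.mem_singleton, ← hx, mem_exits]
    exact ⟨hz, hz'⟩
  have hye : ∀ z ∈ Y, y + z ∉ Y → z = q := fun z hz hz' => by
    rw [← Finset.mem_singleton, ← hy, mem_exits]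
    exact ⟨hz, hz'⟩
  -- Compare the routes from z to x + y + z through y + z and through x + z. If both midpoints lie
  -- in Y, the landing points agree; if neither does, the exits agree; the mixed cases force x = 0
  -- or y = 0.
  have : ∃ z ∈ Y, x + y + z ∉ Y := by
    by_contra hcon
    push Not at hcon
    exact hxy (hap _ hcon)
  obtain ⟨z, hz, hw⟩ := this
  have hw1 : x + (y + z) ∉ Y := by rwa [← add_assoc]
  have hw2 : y + (x + z) ∉ Y := by rwa [add_left_comm]
  by_cases h1 : y + z ∈ Y
  · have e1 := hxe _ h1 hw1
    by_cases h2 : x + z ∈ Y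
    · have e2 := hye _ h2 hw2
      left
      rw [← e1, ← e2, add_left_comm]
    · have e2 := hxe _ hz h2
      exact absurd (by rw [e2] at e1; simpa using e1) hy0
  · have e1 := hye _ hz h1
    by_cases h2 : x + z ∈ Y
    · have e2 := hye _ h2 hw2
      exact absurd (by rw [e1] at e2; simpa using e2) hx0
    · right
      rw [← e1, hxe _ hz h2]

/-- An element agreeing in `g` with both members of a pair that agrees in `f` would make that pair
equal. The third element `d` serves when z is opposite to `a` or `b`. -/
theorem eq_of_eq_of_exchange {E : Set G} {f g : G → G}
    (hrel : ∀ x ∈ E, ∀ y ∈ E, x ≠ y → x + y ≠ 0 → f x = f y ∨ g x = g y)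
    (hinj : ∀ x ∈ E, ∀ y ∈ E, f x = f y → g x = g y → x = y) {a b d : G} (ha : a ∈ E) (hb : b ∈ E)
    (hd : d ∈ E) (hab : a ≠ b) (had : a ≠ d) (hbd : b ≠ d) (had' : a + d ≠ 0)
    (hbd' : b + d ≠ 0) (hf : f a = f b) : ∀ z ∈ E, f z = f a := by
  have tri : ∀ x ∈ E, ∀ y ∈ E, ∀ z ∈ E, x ≠ y → z ≠ x → z ≠ y → z + x ≠ 0 → z + y ≠ 0 →
      f x = f y → f z = f x := by
    intro x hx y hy z hz hxy hzx hzy hzx' hzy' hxf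
    rcases hrel z hz x hx hzx hzx' with h1 | h1
    · exact h1
    rcases hrel z hz y hy hzy hzy' with h2 | h2
    · rw [h2, hxf]
    · exact absurd (hinj x hx y hy hxf (h1.symm.trans h2)) hxy
  have hfd : f d = f a := tri a ha b hb d hd hab had.symm hbd.symm (by rwa [add_comm])
    (by rwa [add_comm]) hf
  intro z hz
  by_cases hza : z = a
  · rw [hza]
  by_cases hzb : z = b
  · rw [hzb, hf]
  by_cases hza' : z + a = 0
  · have e : z = -a := eq_neg_of_add_eq_zero_left hza'
    rw [hf]
    refine tri b hb d hd z hz hbd hzb ?_ ?_ ?_ (hf.symm.trans hfd.symm)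
    · rintro rfl
      exact had' (by rw [add_comm, hza'])
    · intro h
      rw [← hza'] at h
      exact hab (add_left_cancel h).symm
    · intro h
      rw [← hza'] at h
      exact had (add_left_cancel h).symm
  by_cases hzb' : z + b = 0
  · refine tri a ha d hd z hz had hza ?_ hza' ?_ hfd.symm
    · rintro rfl
      exact hbd' (by rw [add_comm, hzb'])
    · intro h
      rw [← hzb'] at h
      exact hbd (add_left_cancel h).symm
  exact tri a ha b hb z hz hab hza hzb hza' hzb' hf

theorem const_or_const_of_exchange {E : Set G} {f g : G → G}
    (hrel : ∀ x ∈ E, ∀ y ∈ E, x ≠ y → x + y ≠ 0 → f x = f y ∨ g x = g y)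
    (hinj : ∀ x ∈ E, ∀ y ∈ E, f x = f y → g x = g y → x = y) {a b d : G} (ha : a ∈ E) (hb : b ∈ E)
    (hd : d ∈ E) (hab : a ≠ b) (had : a ≠ d) (hbd : b ≠ d) (hab' : a + b ≠ 0) (had' : a + d ≠ 0)
    (hbd' : b + d ≠ 0) : (∀ z ∈ E, f z = f a) ∨ ∀ z ∈ E, g z = g a := by
  rcases hrel a ha b hb hab hab' with h | h
  · exact Or.inl (eq_of_eq_of_exchange hrel hinj ha hb hd hab had hbd had' hbd' h)
  · exact Or.inr (eq_of_eq_of_exchange (fun x hx y hy h1 h2 => (hrel x hx y hy h1 h2).symm)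
      (fun x hx y hy h1 h2 => hinj x hx y hy h2 h1) ha hb hd hab had hbd had' hbd' h)

theorem exists_three {A : Finset G} (h3 : 3 ≤ A.card)
    (h5 : ∀ g ∈ A, -g ∈ A → g ≠ -g → 5 ≤ A.card) :
    ∃ a ∈ A, ∃ b ∈ A, ∃ d ∈ A, a ≠ b ∧ a ≠ d ∧ b ≠ d ∧ a + b ≠ 0 ∧ a + d ≠ 0 ∧ b + d ≠ 0 := by
  by_cases hopp : ∃ g ∈ A, -g ∈ A ∧ g ≠ -g
  · obtain ⟨g, hg, hg', hgn⟩ := hopp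
    have h := h5 g hg hg' hgn
    have c1 : (A \ {g, -g}).card ≥ 3 := by
      have := Finset.le_card_sdiff {g, -g} A
      have := Finset.card_le_two (a := g) (b := -g)
      omega
    obtain ⟨b, hb⟩ := Finset.card_pos.1 (by omega : 0 < (A \ {g, -g}).card)
    have c2 : ((A \ {g, -g}) \ {b, -b}).card ≥ 1 := by
      have := Finset.le_card_sdiff {b, -b} (A \ {g, -g})
      have := Finset.card_le_two (a := b) (b := -b)
      omega
    obtain ⟨d, hd⟩ := Finset.card_pos.1 (by omega : 0 < ((A \ {g, -g}) \ {b, -b}).card)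
    simp only [Finset.mem_sdiff, Finset.mem_insert, Finset.mem_singleton, not_or] at hb hd
    refine ⟨g, hg, b, hb.1, d, hd.1.1, Ne.symm hb.2.1, Ne.symm hd.1.2.1, Ne.symm hd.2.1, ?_, ?_, ?_⟩
    · exact fun h => hb.2.2 (eq_neg_of_add_eq_zero_right h)
    · exact fun h => hd.1.2.2 (eq_neg_of_add_eq_zero_right h)
    · exact fun h => hd.2.2 (eq_neg_of_add_eq_zero_right h)
  · have key : ∀ x ∈ A, ∀ y ∈ A, x ≠ y → x + y ≠ 0 := by
      intro x hx y hy hxy h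
      have e := eq_neg_of_add_eq_zero_right h
      exact hopp ⟨x, hx, e ▸ hy, fun hc => hxy (hc.trans e.symm)⟩
    obtain ⟨a, b, d, ha, hb, hd, hab, had, hbd⟩ := Finset.two_lt_card_iff.1 (by omega : 2 < A.card)
    exact ⟨a, ha, b, hb, d, hd, hab, had, hbd, key _ ha _ hb hab, key _ ha _ hd had,
      key _ hb _ hd hbd⟩

end Exits

/-! ### Counting representations in a finite group -/

section Counting

variable {G : Type u} [AddCommGroup G] [DecidableEq G]

theorem two_mul_card_le_add_card_filter {Z B : Finset G} (hsub : ∀ z ∈ Z, ∀ w ∈ Z, z - w ∈ Z)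
    (hB : B ⊆ Z) {t : G} (ht : t ∈ Z) :
    2 * B.card ≤ Z.card + (B.filter fun b => t - b ∈ B).card := by
  have h1 := Finset.card_union_add_card_inter B (B.image fun b => t - b)
  rw [Finset.card_image_of_injective _ (sub_right_injective (b := t))] at h1
  have h2 : (B ∪ B.image fun b => t - b).card ≤ Z.card := by
    refine Finset.card_le_card (Finset.union_subset hB fun x hx => ?_)
    obtain ⟨b, hb, rfl⟩ := Finset.mem_image.1 hx
    exact hsub t ht b (hB hb)
  have h3 : (B ∩ B.image fun b => t - b).card ≤ (B.filter fun b => t - b ∈ B).card := by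
    refine Finset.card_le_card fun x hx => ?_
    obtain ⟨hx1, hx2⟩ := Finset.mem_inter.1 hx
    obtain ⟨b, hb, rfl⟩ := Finset.mem_image.1 hx2
    exact Finset.mem_filter.2 ⟨hx1, by simpa using hb⟩
  omega

theorem two_mul_card_le_of_disjoint {Z P : Finset G} (hP : P ⊆ Z)
    (hadd : ∀ z ∈ Z, ∀ w ∈ Z, z + w ∈ Z) {k : G} (hk : k ∈ Z)
    (hd : ∀ p ∈ P, ∀ q ∈ P, k + p ≠ q) : 2 * P.card ≤ Z.card := by
  have hdisj : Disjoint P (P.image fun p => k + p) := by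
    rw [Finset.disjoint_left]
    intro x hx hx'
    obtain ⟨p, hp, rfl⟩ := Finset.mem_image.1 hx'
    exact hd p hp _ hx rfl
  have h := Finset.card_le_card (Finset.union_subset hP
    (Finset.image_subset_iff.2 fun p hp => hadd k hk p (hP hp)) :
    P ∪ (P.image fun p => k + p) ⊆ Z)
  rw [Finset.card_union_of_disjoint hdisj,
    Finset.card_image_of_injective _ (add_right_injective k)] at h
  omega

/-- In a small finite group `Z`, each element is a sum of at most `r + 1` distinct elements of a
large subset. -/
theorem false_of_card_le {Z A : Finset G} {r : ℕ} {σ : G}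
    (hadd : ∀ z ∈ Z, ∀ w ∈ Z, z + w ∈ Z) (hsub : ∀ z ∈ Z, ∀ w ∈ Z, z - w ∈ Z) (hAZ : A ⊆ Z)
    (hσZ : σ ∈ Z) (h0 : (0 : G) ∉ A) (hσ0 : σ ≠ 0) (hσA : σ ∉ A)
    (h2 : ∀ a ∈ A, ∀ b ∈ A, a ≠ b → σ ≠ a + b)
    (h3 : 2 ≤ r → ∀ a ∈ A, ∀ b ∈ A, ∀ c ∈ A, a ≠ b → a ≠ c → b ≠ c → σ ≠ a + b + c)
    (hr : 1 ≤ r) (hA : r + 2 ≤ A.card) (hZ : Z.card ≤ r + 1 + A.card) : False := by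
  have h0Z : (0 : G) ∈ Z := by simpa using hsub σ hσZ σ hσZ
  set B := insert 0 A with hB
  have hBZ : B ⊆ Z := Finset.insert_subset h0Z hAZ
  have hBc : B.card = A.card + 1 := Finset.card_insert_of_notMem h0
  have hmemB : ∀ x ∈ B, x ≠ 0 → x ∈ A := fun x hx hx0 => (Finset.mem_insert.1 hx).resolve_left hx0
  have hσB : σ ∉ B := fun h => hσA (hmemB σ h hσ0)
  -- |F| ≥ |A| + 1 − r ≥ 3, and each b ∈ F satisfies 2b = σ, since otherwise b and σ − b represent σ
  -- by at most two distinct elements of A.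
  set F := B.filter fun b => σ - b ∈ B with hF
  have hFc := two_mul_card_le_add_card_filter hsub hBZ hσZ
  rw [← hF] at hFc
  have hFd : ∀ a ∈ F, a + a = σ := by
    intro a ha
    obtain ⟨haB, haB'⟩ := Finset.mem_filter.1 ha
    by_contra hne
    have ha0 : a ≠ 0 := by
      rintro rfl
      rw [sub_zero] at haB'
      exact hσB haB'
    have ha1 : σ - a ≠ 0 := fun h => hσB (sub_eq_zero.1 h ▸ haB)
    refine h2 a (hmemB a haB ha0) (σ - a) (hmemB _ haB' ha1) (fun h => hne ?_) (by abel)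
    exact (eq_sub_iff_add_eq.1 h)
  have hFZ : F ⊆ Z := (Finset.filter_subset _ _).trans hBZ
  obtain ⟨a1, ha1, a2, ha2, hne⟩ := Finset.one_lt_card.1 (by omega : 1 < F.card)
  by_cases hr2 : 2 ≤ r
  -- A representation of σ − t by distinct elements of B \ {t} would write σ with at most three
  -- terms of A. The resulting halves of σ − t are disjoint from their translate by a1 − a2, of
  -- order two, whence 2|A| ≤ |Z|.
  · have hex : ∀ t ∈ A, ∃ a ∈ Z, a + a = σ - t := by
      intro t ht
      have htB : t ∈ B := Finset.mem_insert_of_mem ht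
      have hc := two_mul_card_le_add_card_filter hsub ((Finset.erase_subset t B).trans hBZ)
        (hsub σ hσZ t (hAZ ht))
      rw [Finset.card_erase_of_mem htB, hBc] at hc
      obtain ⟨a, ha⟩ := Finset.card_pos.1
        (by omega : 0 < ((B.erase t).filter fun b => σ - t - b ∈ B.erase t).card)
      obtain ⟨ha', hb'⟩ := Finset.mem_filter.1 ha
      obtain ⟨hat, haB⟩ := Finset.mem_erase.1 ha'
      obtain ⟨hbt, hbB⟩ := Finset.mem_erase.1 hb'
      refine ⟨a, hBZ haB, ?_⟩
      by_contra hcon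
      set b := σ - t - a with hb
      have hab : a ≠ b := fun h => hcon (by rw [hb] at h; exact eq_sub_iff_add_eq.1 h)
      have hsum : σ = t + a + b := by
        rw [hb]
        abel
      by_cases ha0 : a = 0
      · have hb0 : b ≠ 0 := fun h => hab (ha0.trans h.symm)
        exact h2 t ht b (hmemB b hbB hb0) hbt.symm (by rw [hsum, ha0, add_zero])
      · by_cases hb0 : b = 0
        · exact h2 t ht a (hmemB a haB ha0) hat.symm (by rw [hsum, hb0, add_zero])
        · exact h3 hr2 t ht a (hmemB a haB ha0) b (hmemB b hbB hb0) hat.symm hbt.symm hab hsum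
    choose! f hfZ hf using hex
    have hinj : Set.InjOn f A := by
      intro t ht t' ht' h
      have e1 := hf t ht
      rw [h, hf t' ht'] at e1
      exact (sub_right_injective e1).symm
    have hk : (a1 - a2) + (a1 - a2) = 0 := by
      have : (a1 - a2) + (a1 - a2) = (a1 + a1) - (a2 + a2) := by abel
      rw [this, hFd a1 ha1, hFd a2 ha2, sub_self]
    have := two_mul_card_le_of_disjoint (P := A.image f)
      (Finset.image_subset_iff.2 fun t ht => hfZ t ht) hadd (hsub a1 (hFZ ha1) a2 (hFZ ha2)) (by
        intro p hp q hq h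
        obtain ⟨t, ht, rfl⟩ := Finset.mem_image.1 hp
        obtain ⟨t', ht', rfl⟩ := Finset.mem_image.1 hq
        have e : f t + f t = f t' + f t' := by
          rw [← h]
          calc f t + f t = (a1 - a2) + (a1 - a2) + (f t + f t) := by rw [hk, zero_add]
            _ = _ := by abel
        rw [hf t ht, hf t' ht'] at e
        have e' : t = t' := sub_right_injective e
        rw [← e'] at h
        exact hne (sub_eq_zero.1 (by simpa using h)))
    rw [Finset.card_image_of_injOn hinj] at this
    omega
  -- Here r = 1 and |F| ≥ |A| ≥ 3. If 2w ≠ 0, then F and w + F are disjoint, too large for Z.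
  · have hall : ∀ w ∈ Z, w + w = 0 := by
      intro w hw
      by_contra hcon
      have := two_mul_card_le_of_disjoint hFZ hadd hw (by
        intro p hp q hq h
        have e : q + q = (w + w) + (p + p) := by
          rw [← h]
          abel
        rw [hFd p hp, hFd q hq] at e
        exact hcon (by simpa using e))
      omega
    exact hσ0 (by rw [← hFd a1 ha1, hall a1 (hFZ ha1)])

end Counting

/-! ### The support bound for distinct terms -/

section SumBound

variable {G : Type u} [AddCommGroup G] [DecidableEq G]

theorem sum_add_mem_of_closed {E : Set G} {Z : Finset G} (h : ∀ x ∈ E, ∀ z ∈ Z, x + z ∈ Z)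
    (U : Multiset G) (hU : ∀ x ∈ U, x ∈ E) {z : G} (hz : z ∈ Z) : U.sum + z ∈ Z := by
  induction U using Multiset.induction_on with
  | empty => simpa using hz
  | cons a U ih =>
    rw [Multiset.sum_cons, add_assoc]
    exact h a (hU a (Multiset.mem_cons_self a U)) _
      (ih fun x hx => hU x (Multiset.mem_cons_of_mem hx))

/-- A large set of distinct terms: the aperiodic case, given the bound for all deletions of one
term. -/
theorem Aper.le_card_lsum_val {A : Finset G} {r : ℕ} (hap : Aper (lsum (r + 1) A.val)) (hr : 1 ≤ r)
    (h0 : (0 : G) ∉ A) (hσ : A.val.sum ∉ lsum (r + 1) A.val)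
    (ih : ∀ g ∈ A, r + (A.card - 1) ≤ (lsum r (A.val.erase g)).card) :
    r + 1 + A.card ≤ (lsum (r + 1) A.val).card := by
  by_contra hcon
  have hs : r + 1 < A.card := lt_card_of_sum_notMem hσ
  have hsum : ∀ B ⊆ A, A.val.sum = ∑ b ∈ B, b → r + 1 < B.card := by
    intro B hB he
    by_contra hc
    exact hσ (he ▸ sum_mem_lsum hB (by omega))
  have hAY : A ⊆ lsum (r + 1) A.val := fun a ha => mem_lsum.2
    ⟨{a}, Multiset.singleton_le.2 ha, by simp, by simp⟩
  have h0Y := zero_mem_lsum (r + 1) A.val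
  have hspan : ∀ y ∈ lsum (r + 1) A.val, ∃ U : Multiset G, (∀ x ∈ U, x ∈ A) ∧ U.sum = y := by
    intro y hy
    obtain ⟨U, hU, -, rfl⟩ := mem_lsum.1 hy
    exact ⟨U, fun x hx => Multiset.mem_of_le hU hx, rfl⟩
  have hsub : ∀ g ∈ A, exits (lsum (r + 1) A.val) g ⊆
      lsum (r + 1) A.val \ lsum r (A.val.erase g) := by
    intro g hg y hy
    obtain ⟨hy1, hy2⟩ := mem_exits.1 hy
    exact Finset.mem_sdiff.2 ⟨hy1, fun h => hy2 (add_mem_lsum hg h)⟩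
  -- Exits avoid the sums of at most r terms other than g, and the failed bound leaves at most one
  -- such point. Aperiodicity provides one.
  have hex1 : ∀ g ∈ A, (exits (lsum (r + 1) A.val) g).card = 1 := by
    intro g hg
    have h1 := Finset.card_le_card (hsub g hg)
    rw [Finset.card_sdiff_of_subset (lsum_erase_subset r A.val g)] at h1
    have h2 := ih g hg
    have h3 : 0 < (exits (lsum (r + 1) A.val) g).card := by
      rw [Finset.card_pos, Finset.nonempty_iff_ne_empty]
      intro he
      refine h0 ((hap g fun y hy => ?_) ▸ hg)
      by_contra hy'
      have : y ∈ exits (lsum (r + 1) A.val) g := mem_exits.2 ⟨hy, hy'⟩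
      rw [he] at this
      exact Finset.notMem_empty _ this
    omega
  obtain ⟨Y, hY⟩ : ∃ Y, Y = lsum (r + 1) A.val := ⟨_, rfl⟩
  rw [← hY] at hap hσ hcon hAY h0Y hspan hex1
  set E : Set G := {x | x ∈ A ∨ -x ∈ A} with hE
  have hEA : ∀ x ∈ A, x ∈ E := fun x hx => Or.inl hx
  have hEn : ∀ x ∈ E, -x ∈ E := by
    rintro x (hx | hx)
    · right
      rwa [neg_neg]
    · exact Or.inl hx
  have hE0 : ∀ x ∈ E, x ≠ 0 := by
    rintro x (hx | hx) rfl
    · exact h0 hx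
    · rw [neg_zero] at hx
      exact h0 hx
  have hα : ∀ x ∈ E, ∃ p, exits Y x = {p} := by
    rintro x (hx | hx)
    · exact Finset.card_eq_one.1 (hex1 x hx)
    · rw [← Finset.card_eq_one, ← card_exits_neg]
      exact hex1 _ hx
  choose! α hα using hα
  have hαm : ∀ x ∈ E, α x ∈ Y ∧ x + α x ∉ Y := fun x hx => by
    rw [← mem_exits, hα x hx, Finset.mem_singleton]
  have hαu : ∀ x ∈ E, ∀ y ∈ Y, x + y ∉ Y → y = α x := fun x hx y hy hy' => by
    rw [← Finset.mem_singleton, ← hα x hx, mem_exits]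
    exact ⟨hy, hy'⟩
  obtain ⟨a, ha, b, hb, d, hd, hab, had, hbd, hab', had', hbd'⟩ :=
    -- Dropping a pair g, −g from A keeps the sum, so |A| − 2 > r + 1.
    exists_three (A := A) (by omega) (by
      intro g hg hg' hne
      have h1 : ({g, -g} : Finset G) ⊆ A :=
        Finset.insert_subset hg (Finset.singleton_subset_iff.2 hg')
      have h2 := Finset.sum_sdiff (f := fun x : G => x) h1
      rw [Finset.sum_pair hne, add_neg_cancel, add_zero] at h2
      have h3 := hsum (A \ {g, -g}) Finset.sdiff_subset (by
        rw [h2, Finset.sum, Multiset.map_id'])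
      rw [Finset.card_sdiff_of_subset h1, Finset.card_pair hne] at h3
      omega)
  have key := const_or_const_of_exchange (E := E) (f := fun x => x + α x) (g := α)
    (fun x hx y hy _ hxy => exits_exchange hap (hα x hx) (hα y hy) (hE0 x hx) (hE0 y hy) hxy)
    (fun x _ y _ h1 h2 => by
      simp only [h2] at h1
      exact add_right_cancel h1)
    (hEA a ha) (hEA b hb) (hEA d hd) hab had hbd hab' had' hbd'
  rcases key with hc | hc
  -- All translations land on c, and adding c to Y gives a set closed under them: x + c is the exit
  -- of −x.
  · set c := a + α a with hcdef
    have hcY : c ∉ Y := (hαm a (hEA a ha)).2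
    have hclosed : ∀ x ∈ E, ∀ z ∈ insert c Y, x + z ∈ insert c Y := by
      intro x hx z hz
      rcases Finset.mem_insert.1 hz with rfl | hz
      · have h1 : -x + α (-x) = c := hc _ (hEn x hx)
        rw [← h1, add_neg_cancel_left]
        exact Finset.mem_insert_of_mem (hαm _ (hEn x hx)).1
      · by_cases h : x + z ∈ Y
        · exact Finset.mem_insert_of_mem h
        · rw [hαu x hx z hz h, show x + α x = c from hc x hx]
          exact Finset.mem_insert_self _ _
    have hσc : A.val.sum = c := by
      have h1 := sum_add_mem_of_closed hclosed A.val (fun x hx => hEA x hx)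
        (Finset.mem_insert_of_mem h0Y)
      rw [add_zero] at h1
      exact (Finset.mem_insert.1 h1).resolve_right hσ
    have hspan' : ∀ z ∈ insert c Y, ∃ U : Multiset G, (∀ x ∈ U, x ∈ A) ∧ U.sum = z := by
      intro z hz
      rcases Finset.mem_insert.1 hz with rfl | hz
      · exact ⟨A.val, fun x hx => hx, hσc⟩
      · exact hspan z hz
    refine false_of_card_le (Z := insert c Y) (A := A) (r := r) (σ := c) ?_ ?_
      (fun x hx => Finset.mem_insert_of_mem (hAY hx)) (Finset.mem_insert_self _ _) h0
      (fun h => hcY (h ▸ h0Y)) (fun h => hcY (hAY h)) ?_ ?_ hr (by omega) ?_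
    · intro z hz w hw
      obtain ⟨U, hU, rfl⟩ := hspan' z hz
      exact sum_add_mem_of_closed hclosed U (fun x hx => hEA x (hU x hx)) hw
    · intro z hz w hw
      obtain ⟨U, hU, rfl⟩ := hspan' w hw
      have h1 := sum_add_mem_of_closed hclosed (U.map Neg.neg) (by
        intro x hx
        obtain ⟨u, hu, rfl⟩ := Multiset.mem_map.1 hx
        exact hEn u (hEA u (hU u hu))) hz
      rw [Multiset.sum_map_neg', neg_add_eq_sub] at h1
      exact h1
    · intro x hx y hy hxy h
      have h1 := hsum {x, y} (Finset.insert_subset hx (Finset.singleton_subset_iff.2 hy))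
        (by rw [Finset.sum_pair hxy, hσc, h])
      rw [Finset.card_pair hxy] at h1
      omega
    · intro hr2 x hx y hy z hz hxy hxz hyz h
      have h2 : x ∉ ({y, z} : Finset G) := by simp [hxy, hxz]
      have h1 := hsum {x, y, z} (Finset.insert_subset hx
        (Finset.insert_subset hy (Finset.singleton_subset_iff.2 hz)))
        (by rw [Finset.sum_insert h2, Finset.sum_pair hyz, hσc, h, add_assoc])
      rw [Finset.card_insert_of_notMem h2, Finset.card_pair hyz] at h1
      omega
    · rw [Finset.card_insert_of_notMem hcY]
      omega
  · have hclosed : ∀ x ∈ E, ∀ z ∈ Y.erase (α a), x + z ∈ Y.erase (α a) := by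
      intro x hx z hz
      obtain ⟨hz1, hz2⟩ := Finset.mem_erase.1 hz
      refine Finset.mem_erase.2 ⟨fun h => ?_, ?_⟩
      · refine (hαm (-x) (hEn x hx)).2 ?_
        rw [hc _ (hEn x hx), ← h, neg_add_cancel_left]
        exact hz2
      · by_contra h
        exact hz1 ((hαu x hx z hz2 h).trans (hc x hx))
    have hne : (0 : G) ≠ α a := by
      intro h
      have h1 := (hαm a (hEA a ha)).2
      rw [← h, add_zero] at h1
      exact h1 (hAY ha)
    have h1 := sum_add_mem_of_closed hclosed A.val (fun x hx => hEA x hx)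
      (Finset.mem_erase.2 ⟨hne, h0Y⟩)
    rw [add_zero] at h1
    exact hσ (Finset.mem_of_mem_erase h1)

end SumBound

/-! ### Zero terms as padding -/

section NonzeroTerms

variable {G : Type u} [AddCommGroup G] [DecidableEq G]

theorem mem_lsum_iff_mem_sums {r : ℕ} {T : Multiset G} {y : G} :
    y ∈ lsum r T ↔ ∃ k ≤ r, y ∈ sums k T := by
  rw [mem_lsum]
  constructor
  · rintro ⟨U, hU, hc, rfl⟩
    exact ⟨_, hc, mem_sums.2 ⟨U, hU, rfl, rfl⟩⟩
  · rintro ⟨k, hk, hy⟩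
    obtain ⟨U, hU, rfl, rfl⟩ := mem_sums.1 hy
    exact ⟨U, hU, hk, rfl⟩

theorem image_lsum {G' : Type*} [AddCommGroup G'] [DecidableEq G'] (f : G →+ G') (r : ℕ)
    (T : Multiset G) : (lsum r T).image f = lsum r (T.map f) := by
  ext y
  simp only [Finset.mem_image, mem_lsum_iff_mem_sums, ← image_sums]
  grind

theorem sum_filter_ne_zero (U : Multiset G) : (U.filter (· ≠ 0)).sum = U.sum := by
  induction U using Multiset.induction_on with
  | empty => simp
  | cons a U ih =>
    by_cases h : a = 0
    · rw [Multiset.filter_cons_of_neg (p := fun x : G => x ≠ 0) U (not_not.2 h), ih,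
        h, Multiset.sum_cons, zero_add]
    · rw [Multiset.filter_cons_of_pos (p := fun x : G => x ≠ 0) U h, Multiset.sum_cons, Multiset.sum_cons, ih]

theorem lsum_filter_ne_zero (r : ℕ) (T : Multiset G) : lsum r (T.filter (· ≠ 0)) = lsum r T := by
  ext y
  simp only [mem_lsum]
  constructor
  · rintro ⟨U, hU, h⟩
    exact ⟨U, hU.trans (Multiset.filter_le _ _), h⟩
  · rintro ⟨U, hU, hc, h⟩
    exact ⟨U.filter (· ≠ 0), Multiset.filter_le_filter _ hU,
      (Multiset.card_le_card (Multiset.filter_le _ _)).trans hc, by rw [sum_filter_ne_zero, h]⟩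

theorem sums_eq_lsum {r : ℕ} {S : Multiset G} (h : r ≤ S.count 0) : sums r S = lsum r S := by
  rw [← lsum_filter_ne_zero]
  ext y
  rw [mem_sums, mem_lsum]
  constructor
  · rintro ⟨U, hU, rfl, rfl⟩
    exact ⟨U.filter (· ≠ 0), Multiset.filter_le_filter _ hU,
      Multiset.card_le_card (Multiset.filter_le _ _), sum_filter_ne_zero U⟩
  · rintro ⟨U, hU, hc, rfl⟩
    refine ⟨Multiset.replicate (r - Multiset.card U) 0 + U, ?_, ?_, by simp⟩
    · rw [← Multiset.filter_add_not (· = 0) S, Multiset.filter_eq']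
      exact add_le_add (Multiset.replicate_mono 0 (by omega)) hU
    · rw [Multiset.card_add, Multiset.card_replicate]
      omega

theorem card_toFinset_le_card_filter_ne_zero (T : Multiset G) :
    T.toFinset.card ≤ (T.filter (· ≠ 0)).toFinset.card + 1 := by
  refine (Finset.card_le_card (t := insert 0 (T.filter (· ≠ 0)).toFinset) fun x hx => ?_).trans
    (Finset.card_insert_le _ _)
  by_cases h : x = 0
  · exact Finset.mem_insert.2 (Or.inl h)
  · exact Finset.mem_insert_of_mem
      (Multiset.mem_toFinset.2 (Multiset.mem_filter.2 ⟨Multiset.mem_toFinset.1 hx, h⟩))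

end NonzeroTerms

/-! ### The support bound and the final reduction -/

section Bounds

theorem card_le_card_mul_card_image {G : Type u} [AddCommGroup G] [Fintype G] [DecidableEq G]
    (H : AddSubgroup G) [DecidableEq (G ⧸ H)] (E : Finset G) :
    E.card ≤ Nat.card H * (E.image (QuotientAddGroup.mk' H)).card := by
  rw [← card_cl]
  exact Finset.card_le_card (subset_cl H E)

theorem notMem_image_mk {G : Type u} [AddCommGroup G] {Y : Finset G} {H : AddSubgroup G}
    [DecidableEq (G ⧸ H)] (h : IsPer H Y) {x : G} (hx : x ∉ Y) :
    QuotientAddGroup.mk' H x ∉ Y.image (QuotientAddGroup.mk' H) := by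
  intro hmem
  obtain ⟨y, hy, hyx⟩ := Finset.mem_image.1 hmem
  refine hx (h.of_sub_mem hy ?_)
  rw [← neg_add_eq_sub]
  exact QuotientAddGroup.eq.1 hyx

/-- The lower bound for the number of sums of at most `r` terms, in every finite group. -/
def SupportBound (r : ℕ) : Prop :=
  ∀ (G : Type u) [AddCommGroup G] [Fintype G] [DecidableEq G] (T : Multiset G), (0 : G) ∉ T →
    T.sum ∉ lsum r T → r + T.toFinset.card ≤ (lsum r T).card

/-- Terms that vanish modulo the stabilizer H are discarded. Counting 0 with the support makes up
for them: |supp T| + 1 ≤ |H|(s + 1) for s nonzero classes, and |H|(r − 1) ≥ r − 1. -/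
theorem SupportBound.of_aper {r : ℕ} (hr : 1 ≤ r)
    (h : ∀ (G : Type u) [AddCommGroup G] [Fintype G] [DecidableEq G] (T : Multiset G),
      (0 : G) ∉ T → T.sum ∉ lsum r T → Aper (lsum r T) →
        r + T.toFinset.card ≤ (lsum r T).card) : SupportBound.{u} r := by
  intro G _ _ _ T h0 hσ
  classical
  have hper := isPer_stab (lsum r T)
  have hap := aper_image_stab (lsum r T)
  generalize stab (lsum r T) = H at hper hap
  have : Fintype (G ⧸ H) := Fintype.ofFinite _
  have hσ' := notMem_image_mk hper hσ
  rw [map_multiset_sum, ← sum_filter_ne_zero, image_lsum, ← lsum_filter_ne_zero] at hσ'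
  rw [image_lsum, ← lsum_filter_ne_zero] at hap
  have h1 := h _ _ (by simp) hσ' hap
  rw [lsum_filter_ne_zero, ← image_lsum] at h1
  have h2 := hper.card_eq
  have h3 := card_le_card_mul_card_image H (insert 0 T.toFinset)
  rw [Finset.card_insert_of_notMem (by simpa using h0)] at h3
  have h4 : ((insert 0 T.toFinset).image (QuotientAddGroup.mk' H)).card ≤
      ((T.map (QuotientAddGroup.mk' H)).filter (· ≠ 0)).toFinset.card + 1 := by
    refine (Finset.card_le_card fun x hx => ?_).trans (Finset.card_insert_le 0 _)
    obtain ⟨y, hy, rfl⟩ := Finset.mem_image.1 hx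
    by_cases hy0 : QuotientAddGroup.mk' H y = 0
    · exact Finset.mem_insert.2 (Or.inl hy0)
    · refine Finset.mem_insert_of_mem (Multiset.mem_toFinset.2 (Multiset.mem_filter.2 ⟨?_, hy0⟩))
      rcases Finset.mem_insert.1 hy with rfl | hy
      · exact absurd (map_zero _) hy0
      · exact Multiset.mem_map_of_mem _ (Multiset.mem_toFinset.1 hy)
  have h5 : 0 < Nat.card H := Nat.card_pos
  rw [h2]
  nlinarith [Nat.mul_le_mul_left (Nat.card H) h1, Nat.mul_le_mul_left (Nat.card H) h4,
    Nat.mul_le_mul h5 (le_refl (r - 1)), Nat.sub_add_cancel hr]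

theorem supportBound {r : ℕ} (hr : 1 ≤ r) : SupportBound.{u} r := by
  induction r, hr using Nat.le_induction with
  | base =>
    intro G _ _ _ T h0 _
    rw [lsum_one, Finset.card_insert_of_notMem (by simpa using h0), add_comm]
  | succ r hr ih =>
    refine SupportBound.of_aper (by omega) fun G _ _ _ T h0 hσ hap => ?_
    have hdel : ∀ g ∈ T, r + (T.erase g).toFinset.card ≤ (lsum r (T.erase g)).card := fun g hg =>
      ih G _ (fun h => h0 (Multiset.mem_of_mem_erase h)) (sum_erase_notMem_lsum hg hσ)
    by_cases hnd : T.Nodup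
    · have h1 := hap.le_card_lsum_val (A := ⟨T, hnd⟩) hr h0 hσ (by
        intro g hg
        have h2 := hdel g hg
        rwa [(Multiset.toFinset_card_eq_card_iff_nodup).2 (hnd.erase g),
          Multiset.card_erase_of_mem hg] at h2)
      rwa [(Multiset.toFinset_card_eq_card_iff_nodup).2 hnd]
    · rw [Multiset.nodup_iff_count_le_one] at hnd
      push Not at hnd
      obtain ⟨g, hg⟩ := hnd
      have hgT : g ∈ T := Multiset.count_pos.1 (by omega)
      have h1 : (T.erase g).toFinset = T.toFinset := by
        ext x
        rw [Multiset.mem_toFinset, Multiset.mem_toFinset]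
        refine ⟨Multiset.mem_of_mem_erase, fun hx => ?_⟩
        by_cases hxg : x = g
        · rw [hxg, ← Multiset.count_pos, Multiset.count_erase_self]
          omega
        · exact (Multiset.mem_erase_of_ne hxg).2 hx
      have h2 := hdel g hgT
      rw [h1] at h2
      -- Equality would make the nonzero term `g` a period.
      have h3 : (lsum r (T.erase g)).card < (lsum (r + 1) T).card := by
        refine Finset.card_lt_card (Finset.ssubset_iff_subset_ne.2
          ⟨lsum_erase_subset r T g, fun he => h0 ?_⟩)
        have : g = 0 := hap g fun y hy => add_mem_lsum hgT (he ▸ hy)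
        exact this ▸ hgT
      omega

/-- Divisibility instead of n = |G| allows use in quotients; it suffices for n • q = 0, so that
subtracting q from every term shifts σ(S) and Σ_r(S) alike by r • q. -/
theorem Aper.card_toFinset_le {G : Type u} [AddCommGroup G] [Fintype G] [DecidableEq G]
    {S : Multiset G} {n r : ℕ} (hap : Aper (sums r S)) (hr : 1 ≤ r) (hn : 0 < n)
    (hdvd : Fintype.card G ∣ n) (hS : Multiset.card S = n + r) (hσ : S.sum ∉ sums r S) :
    r + S.toFinset.card ≤ (sums r S).card + 1 := by
  obtain ⟨q, hq⟩ : ∃ q, r < S.count q := by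
    by_contra hcon
    push Not at hcon
    have h1 := hap.sum_min_count_le (by omega)
    rw [Finset.sum_congr rfl fun g _ => min_eq_right (hcon g), Multiset.sum_count_eq_card
      (fun a _ => Finset.mem_univ a), hS] at h1
    have h2 := Finset.card_le_univ (sums r S)
    have h3 := Nat.le_of_dvd hn hdvd
    omega
  have hsub : ∀ U : Multiset G, (U.map (· - q)).sum = U.sum - Multiset.card U • q := by
    intro U
    rw [Multiset.sum_map_sub, Multiset.map_id', Multiset.map_const', Multiset.sum_replicate]
  have hinj : Function.Injective fun x : G => x - q := sub_left_injective
  have hsums : sums r (S.map (· - q)) = (sums r S).image (· - r • q) := by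
    ext y
    simp only [sums, Multiset.powersetCard_map, Finset.mem_image, Multiset.mem_toFinset,
      Multiset.mem_map, Multiset.map_map, Function.comp, hsub]
    constructor
    · rintro ⟨U, hU, rfl⟩
      exact ⟨_, ⟨U, hU, rfl⟩, by rw [(Multiset.mem_powersetCard.1 hU).2]⟩
    · rintro ⟨_, ⟨U, hU, rfl⟩, rfl⟩
      exact ⟨U, hU, by rw [(Multiset.mem_powersetCard.1 hU).2]⟩
  have hcount : r ≤ (S.map (· - q)).count 0 := by
    have := Multiset.count_map_eq_count' (fun x : G => x - q) S hinj q
    rw [sub_self] at this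
    omega
  have hnq : n • q = 0 := by
    obtain ⟨k, rfl⟩ := hdvd
    rw [mul_comm, mul_nsmul', card_nsmul_eq_zero, nsmul_zero]
  have hσ' : (S.map (· - q)).sum ∉ sums r (S.map (· - q)) := by
    rw [hsums, hsub, hS, add_nsmul, hnq, zero_add, Finset.mem_image]
    rintro ⟨y, hy, he⟩
    exact hσ (sub_left_injective he ▸ hy)
  have hc : (sums r (S.map (· - q))).card = (sums r S).card := by
    rw [hsums, Finset.card_image_of_injective _ sub_left_injective]
  rw [sums_eq_lsum hcount, ← lsum_filter_ne_zero] at hσ' hc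
  rw [← sum_filter_ne_zero] at hσ'
  have h1 := supportBound hr G _ (by simp) hσ'
  have h2 := card_toFinset_le_card_filter_ne_zero (S.map (· - q))
  rw [Multiset.toFinset_map, Finset.card_image_of_injective _ hinj] at h2
  omega

theorem card_toFinset_le {G : Type u} [AddCommGroup G] [Fintype G] [DecidableEq G]
    {S : Multiset G} {r : ℕ} (hr : 1 ≤ r) (hS : Multiset.card S = Fintype.card G + r)
    (hσ : S.sum ∉ sums r S) : r + S.toFinset.card ≤ (sums r S).card + 1 := by
  classical
  have hper := isPer_stab (sums r S)
  have hap := aper_image_stab (sums r S)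
  generalize stab (sums r S) = H at hper hap
  have : Fintype (G ⧸ H) := Fintype.ofFinite _
  have hσ' := notMem_image_mk hper hσ
  rw [map_multiset_sum, image_sums] at hσ'
  rw [image_sums] at hap
  have h1 := hap.card_toFinset_le (n := Fintype.card G) hr Fintype.card_pos
    (by
      rw [← Nat.card_eq_fintype_card, ← Nat.card_eq_fintype_card]
      exact AddSubgroup.card_quotient_dvd_card H)
    (by rw [Multiset.card_map, hS]) hσ'
  rw [← image_sums, Multiset.toFinset_map] at h1
  have h2 := hper.card_eq
  have h3 := card_le_card_mul_card_image H S.toFinset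
  have h5 : 0 < Nat.card H := Nat.card_pos
  rw [h2]
  nlinarith [Nat.mul_le_mul_left (Nat.card H) h1,
    Nat.mul_le_mul h5 (le_refl (r - 1)), Nat.sub_add_cancel hr]

/-- Complements in `S` exchange the lengths n and r. -/
theorem sumsOfLength_eq_image {G : Type u} [AddCommGroup G] [DecidableEq G] {S : Multiset G}
    {n r : ℕ} (hS : Multiset.card S = n + r) :
    sumsOfLength n S = ((sums r S).image (S.sum - ·) : Finset G) := by
  have hcompl : ∀ U ≤ S, S.sum - U.sum = (S - U).sum := by
    intro U hU
    rw [sub_eq_iff_eq_add, ← Multiset.sum_add, tsub_add_cancel_of_le hU]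
  ext y
  rw [Finset.mem_coe, Finset.mem_image]
  constructor
  · rintro ⟨U, hU, hc, rfl⟩
    refine ⟨(S - U).sum, mem_sums.2 ⟨_, tsub_le_self, ?_, rfl⟩, ?_⟩
    · rw [Multiset.card_sub hU]
      omega
    · rw [← hcompl U hU, sub_sub_cancel]
  · rintro ⟨_, hz, rfl⟩
    obtain ⟨U, hU, hc, rfl⟩ := mem_sums.1 hz
    refine ⟨S - U, tsub_le_self, ?_, (hcompl U hU).symm⟩
    rw [Multiset.card_sub hU]
    omega

end Bounds

end SeqOver

theorem mainTheorem4 {G : Type*} [AddCommGroup G] [Finite G] (n r : ℕ) (hn : Nat.card G = n)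
    (S : Multiset G) (hS : Multiset.card S = n + r)
    (hr : 1 ≤ r) (hrD : (r : ℤ) ≤ (SeqOver.davenport G : ℤ) - 2)
    (h0 : (0 : G) ∉ SeqOver.sumsOfLength n S) :
    ((SeqOver.sumsOfLength n S).ncard : ℤ) ≥ (r : ℤ) + ((SeqOver.supp S).ncard : ℤ) - 1 := by
  classical
  have : Fintype G := Fintype.ofFinite G
  rw [SeqOver.sumsOfLength_eq_image hS] at h0 ⊢
  rw [Set.ncard_coe_finset, Finset.card_image_of_injective _ sub_right_injective]
  have hsupp : SeqOver.supp S = (S.toFinset : Set G) := by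
    ext x
    simp [SeqOver.supp]
  rw [hsupp, Set.ncard_coe_finset]
  rw [Finset.mem_coe, Finset.mem_image] at h0
  have h1 := SeqOver.card_toFinset_le hr (by rw [hS, ← hn, Nat.card_eq_fintype_card])
    (fun h => h0 ⟨_, h, sub_self _⟩)
  omega
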